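/- Let $G=(V,E)$ be a finite connected graph without loops (multiple edges are allowed), and let $\ell\colon E\to\mathbb Z_{>0}$ be an edge length function. Let $\mathbb E$ be the set of oriented edges; for $e=uv\in\mathbb E$ (tail $u$, head $v$) write $\overline e=vu$, and let $C^1(G,\mathbb R)$ be the space of functions $x\colon\mathbb E\to\mathbb R$ with $x(\overline e)=-x(e)$. Let $d^*\colon C^1(G,\mathbb R)\to H_{0,\mathbb R}:=\{g\colon V\to\mathbb R \mid \sum_v g(v)=0\}$ be given by $d^*(x)(v)=\sum_{e\in\mathbb E\text{ with head }v}x(e)$. For $f\colon V\to\mathbb Z$ and $e=uv\in\mathbb E$ put $\delta_e(f)=\lfloor (f(v)-f(u))/\ell_e\rfloor$ and let $\mathfrak d_f\in C^1(G,\mathbb R)$ be $\mathfrak d_f(e)=\frac12(\delta_e(f)-\delta_{\overline e}(f))$. Let $G_f$ be the spanning subgraph of $G$ whose edges are the edges $uv$ with $\ell_{uv}\mid f(v)-f(u)$. Let $\square_f$ be the cube of all $\mathfrak d_f+\epsilon$ with $\epsilon\in C^1(G,\mathbb R)$, $\|\epsilon\|_\infty\le\frac12$ and $\epsilon(e)=0$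 for every $e$ not in $G_f$. The mixed Voronoi tiling $\mathrm{Vor}_{G,\ell}$ of $H_{0,\mathbb R}$ consists of the polytopes $\mathrm{Vor}_{G,\ell}(f):=d^*(\square_f)$, for all $f$ with $G_f$ connected, and all their non-empty faces. The one-skeleton of its dual is the graph whose vertices are the top-dimensional cells and whose edges are the cells of codimension one, such an edge being incident to the top-dimensional cells that contain it. For $f$ with $G_f$ connected and a proper subset $S\subset V$ such that the induced subgraphs $G_f[S]$ and $G_f[V-S]$ are connected (in particular non-empty), let $h=f+n\chi_S$, where $\chi_S$ is the characteristic function of $S$ and $n$ is the smallest positive integer such that $G_h$ is connected, and put $\eta_{S,f}:=\frac12\eta_f+\frac12\eta_h$. Here, for $k\in\{f,h\}$, $\eta_k\in C^1(G,\mathbb R)$ takes the value $1$ on the oriented edges of $G_k$ from $V-S$ to $S$, $-1$ on the reverse ones, and $0$ on all other oriented edges. Theorem. The one-skeleton of the dual of the mixed Voronoi tiling $\mathrm{Vor}_{G,\ell}$ is isomorphic to the (simple) graph whose vertices are the points $\mathfrak d_f$ for all $f\colon V\to\mathbb Z$ with $G_f$ connected, and whose edges are the pairs $\{\mathfrak d_f,\mathfrak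 d_f+\eta_{S,f}\}$ for all such $f$ and all proper subsets $S\subset V$ with $G_f[S]$ and $G_f[V-S]$ connected. More precisely, each of these pairs consists of two distinct points of the vertex set; there is a bijection from the top-dimensional cells onto the vertex set, which takes $\mathrm{Vor}_{G,\ell}(f)$ to $\mathfrak d_f$, and a bijection from the cells of codimension one onto the edge set, such that a cell of codimension one is contained in a top-dimensional cell if and only if the corresponding edge contains the corresponding vertex. -/

import Mathlib

open scoped Graph

noncomputable section

namespace MixedVoronoi

variable {α β : Type*}

/-- A (multi)graph is connected if it is non-empty and any two vertices are joined by a path. -/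
def Connected (G : Graph α β) : Prop := G.toSimpleGraph.Connected

/-- An oriented edge of `G`: an edge together with one of its two orientations. -/
@[ext]
structure Arrow (G : Graph α β) where
  edge : β
  tail : V(G)
  head : V(G)
  isLink : G.IsLink edge tail head

/-- The oriented edge with the reverse orientation. -/
def Arrow.rev {G : Graph α β} (a : Arrow G) : Arrow G :=
  ⟨a.edge, a.head, a.tail, a.isLink.symm⟩

/-- `C¹(G, ℝ)`: the real functions `x` on oriented edges with `x(ē) = - x(e)`. -/
def C1 (G : Graph α β) : Submodule ℝ (Arrow G → ℝ) where
  carrier := {x | ∀ a, x a.rev = - x a}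
  zero_mem' := fun a => by simp
  add_mem' := fun {x y} hx hy a => by
    simp only [Pi.add_apply, hx a, hy a]; ring
  smul_mem' := fun c x hx a => by
    simp only [Pi.smul_apply, hx a, smul_eq_mul]; ring

/-- `H_{0,ℝ}`: the real functions on the vertices whose values sum to zero. -/
def H0 (G : Graph α β) [Finite V(G)] : Submodule ℝ (V(G) → ℝ) where
  carrier := {g | ∑ᶠ v, g v = 0}
  zero_mem' := by simp
  add_mem' := fun {g h} hg hh => by
    have hg' : ∑ᶠ v, g v = 0 := hg
    have hh' : ∑ᶠ v, h v = 0 := hh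
    change ∑ᶠ v, (g v + h v) = 0
    rw [finsum_add_distrib (Set.toFinite _) (Set.toFinite _), hg', hh', add_zero]
  smul_mem' := fun c g hg => by
    have hg' : ∑ᶠ v, g v = 0 := hg
    change ∑ᶠ v, c • g v = 0
    rw [← smul_finsum, hg', smul_zero]

/-- The adjoint `d^* : C¹(G, ℝ) → C⁰(G, ℝ)` of the coboundary `d`: the value at `v` is the sum of
the values on all oriented edges with head `v`. -/
def dStar {G : Graph α β} (x : C1 G) : V(G) → ℝ :=
  fun v => ∑ᶠ a : {a : Arrow G // a.head = v}, (x : Arrow G → ℝ) a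

/-- `δ_e(f) = ⌊(f(v) - f(u)) / ℓ_e⌋` for an oriented edge `e = uv`
(division of integers by a positive integer rounds down). -/
def delta {G : Graph α β} (ℓ : β → ℕ) (f : V(G) → ℤ) (a : Arrow G) : ℤ :=
  (f a.head - f a.tail) / (ℓ a.edge : ℤ)

/-- The point `𝔡_f`, with `𝔡_f(e) = (δ_e(f) - δ_ē(f)) / 2`. -/
def dPoint {G : Graph α β} (ℓ : β → ℕ) (f : V(G) → ℤ) : C1 G :=
  ⟨fun a => ((delta ℓ f a : ℝ) - (delta ℓ f a.rev : ℝ)) / 2, fun a => by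
    change ((delta ℓ f a.rev : ℝ) - (delta ℓ f a : ℝ)) / 2 =
      -(((delta ℓ f a : ℝ) - (delta ℓ f a.rev : ℝ)) / 2)
    ring⟩

/-- The spanning subgraph `G_f`: its edges are those edges `e = uv` of `G` for which `ℓ_e` divides
`f(v) - f(u)`. -/
def subgraphOf (G : Graph α β) (ℓ : β → ℕ) (f : V(G) → ℤ) : Graph α β :=
  G.restrict {e | ∃ a : Arrow G, a.edge = e ∧ (ℓ e : ℤ) ∣ f a.head - f a.tail}

/-- The cube `□_f`: all `𝔡_f + ε` with `‖ε‖_∞ ≤ 1/2` and `ε = 0` outside `G_f`. -/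
def cube (G : Graph α β) (ℓ : β → ℕ) (f : V(G) → ℤ) : Set (C1 G) :=
  {x | ∃ ε : C1 G, (∀ a, |(ε : Arrow G → ℝ) a| ≤ 1 / 2) ∧
    (∀ a : Arrow G, a.edge ∉ E(subgraphOf G ℓ f) → (ε : Arrow G → ℝ) a = 0) ∧
    x = dPoint ℓ f + ε}

/-- The Voronoi polytope `Vor_{G,ℓ}(f) = d^*(□_f)`. -/
def Vor (G : Graph α β) (ℓ : β → ℕ) (f : V(G) → ℤ) : Set (V(G) → ℝ) :=
  dStar '' cube G ℓ f

/-- The cells of the mixed Voronoi tiling `Vor_{G,ℓ}` of `H_{0,ℝ}`: the non-empty faces (including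
the improper one) of the polytopes `Vor_{G,ℓ}(f)` with `G_f` connected. A non-empty face of a
polytope is the locus where some linear functional attains its maximum. -/
def cells (G : Graph α β) (ℓ : β → ℕ) : Set (Set (V(G) → ℝ)) :=
  {σ | σ.Nonempty ∧
    ∃ f : V(G) → ℤ, Connected (subgraphOf G ℓ f) ∧ IsExposed ℝ (Vor G ℓ f) σ}

/-- The cells of codimension `k` in `H_{0,ℝ}`. In the dual complex, whose cells are the cells of the
tiling with inclusion reversed, these are the cells of dimension `k`. -/
def cellsOfCodim (G : Graph α β) [Finite V(G)] (ℓ : β → ℕ) (k : ℕ) : Set (Set (V(G) → ℝ)) :=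
  {σ | σ ∈ cells G ℓ ∧ Module.finrank ℝ (vectorSpan ℝ σ) + k = Module.finrank ℝ (H0 G)}

/-- The one-skeleton of the dual of the mixed Voronoi tiling: its vertices are the top-dimensional
cells, and two distinct ones are adjacent if a cell of codimension one lies in both. -/
def dualOneSkeleton (G : Graph α β) [Finite V(G)] (ℓ : β → ℕ) :
    SimpleGraph (cellsOfCodim G ℓ 0) where
  Adj P Q := P ≠ Q ∧ ∃ σ ∈ cellsOfCodim G ℓ 1, σ ⊆ P.1 ∧ σ ⊆ Q.1
  symm := ⟨fun _ _ h => ⟨h.1.symm, h.2.imp fun _ hσ => ⟨hσ.1, hσ.2.2, hσ.2.1⟩⟩⟩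
  loopless := ⟨fun _ h => h.1 rfl⟩

/-- For a spanning subgraph `H` of `G`, the extension by zero to `C¹(G, ℝ)` of the characteristic
function of the oriented cut of `H` from `V - S` to `S`: on the edges of `H` it is `1` on oriented
edges from `V - S` to `S`, `-1` on the reverse ones and `0` on the others. -/
def cutFunction (G H : Graph α β) (S : Set α) : C1 G :=
  ⟨fun a => E(H).indicator
      (fun _ => S.indicator 1 (a.head : α) - S.indicator 1 (a.tail : α)) a.edge, fun a => by
    change E(H).indicator _ a.edge = -E(H).indicator _ a.edge
    by_cases h : a.edge ∈ E(H)
    · rw [Set.indicator_of_mem h, Set.indicator_of_mem h]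
      simp [Arrow.rev]
    · rw [Set.indicator_of_notMem h, Set.indicator_of_notMem h, neg_zero]⟩

/-- The function `f + n χ_S`. -/
def shift {G : Graph α β} (f : V(G) → ℤ) (S : Set α) (n : ℕ) : V(G) → ℤ :=
  fun v => f v + n * S.indicator 1 (v : α)

/-- The smallest positive integer `n` for which `G_h` with `h = f + n χ_S` is connected. -/
def firstShift (G : Graph α β) (ℓ : β → ℕ) (f : V(G) → ℤ) (S : Set α) : ℕ :=
  sInf {n : ℕ | 0 < n ∧ Connected (subgraphOf G ℓ (shift f S n))}

/-- `η_{S,f} = ½ η_f + ½ η_h`, where `h = f + n χ_S` with `n` the smallest positive integer such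
that `G_h` is connected, and `η_f`, `η_h` are the extensions by zero of the characteristic functions
of the oriented cuts from `V - S` to `S` in `G_f` and in `G_h`. -/
def eta (G : Graph α β) (ℓ : β → ℕ) (f : V(G) → ℤ) (S : Set α) : C1 G :=
  (1 / 2 : ℝ) • cutFunction G (subgraphOf G ℓ f) S +
    (1 / 2 : ℝ) • cutFunction G (subgraphOf G ℓ (shift f S (firstShift G ℓ f S))) S

/-- The set of all points `𝔡_f` with `G_f` connected. -/
def dVertices (G : Graph α β) (ℓ : β → ℕ) : Set (C1 G) :=
  {x | ∃ f : V(G) → ℤ, Connected (subgraphOf G ℓ f) ∧ dPoint ℓ f = x}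

/-- The set of all pairs `{𝔡_f, 𝔡_f + η_{S,f}}` for `f` with `G_f` connected and proper subsets `S`
of `V` such that `G_f[S]` and `G_f[V - S]` are connected. -/
def dEdges (G : Graph α β) (ℓ : β → ℕ) : Set (Sym2 (C1 G)) :=
  {e | ∃ (f : V(G) → ℤ) (S : Set α), Connected (subgraphOf G ℓ f) ∧ S ⊂ V(G) ∧
    Connected ((subgraphOf G ℓ f).induce S) ∧
    Connected ((subgraphOf G ℓ f).induce (V(G) \ S)) ∧
    e = s(dPoint ℓ f, dPoint ℓ f + eta G ℓ f S)}

/-- The simple graph with vertex set `dVertices` and edge set `dEdges`. -/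
def dGraph (G : Graph α β) (ℓ : β → ℕ) : SimpleGraph (dVertices G ℓ) :=
  (SimpleGraph.fromEdgeSet (dEdges G ℓ)).induce (dVertices G ℓ)

end MixedVoronoi

end

noncomputable section

namespace MixedVoronoi

variable {α β : Type*} {G : Graph α β} {ℓ : β → ℕ} {f g : V(G) → ℤ} {S T : Set α}

/-! ### Connected graphs -/

/-! Write hi_f(a) for `hi ℓ f a` = δ_a(f) + 1/2. The cube □_f is cut out by the inequalities x(a) ≤
hi_f(a) over all oriented edges, and hi_f(a) + hi_f(ā) is 1 on G_f and 0 off it. Since ⟨φ, d^*x⟩ = Σ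
max(grad φ(a), 0) x(a), the face of Vor(f) in direction φ comes from the points with x(a) = hi_f(a)
wherever φ increases. A functional ψ is constant on this face iff ψ is constant along each edge of
G_f on which φ is constant (`mem_levelFunctions_iff_const`). When G_f is connected, codimension zero
therefore means φ constant, and codimension one means that the face is that of χ_S for a bond S:
both sides of the cut are connected in G_f (`exists_isBond_of_finrank_levelFunctions`).

Let h = f + nχ_S with n minimal. Minimality keeps each cut edge from passing its next multiple of ℓ,
so hi_h(ā) = -hi_f(a) for a entering S (`IsBond.hi_nextFun_rev`). This one identity shows that the
facet of f for S is the facet of h for V - S, and that 𝔡_f + η_{S,f} = 𝔡_h.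

No further cell contains the facet. If grad f < grad g on all arrows entering T, then Vor(f) ∩
Vor(g) lies in the face of Vor(f) for χ_T (`Vor_inter_Vor_subset_face`). This applies to every
superlevel set T of g - f. If Vor(g) contains the facet, each such T that is non-empty and proper
equals S, so g is f + mχ_S up to a constant, with m = 0 or m ≥ n; the same argument from h excludes
m > n. The same inclusion recovers a facet from its two cells, and 𝔡_f determines f up to a
constant, which gives both bijections. -/

theorem connected_iff_forall_closed {H : Graph α β} :
    Connected H ↔ V(H).Nonempty ∧ ∀ T : Set α, (∃ v ∈ V(H), v ∈ T) →
      (∀ e x y, H.IsLink e x y → x ∈ T → y ∈ T) → V(H) ⊆ T := by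
  constructor
  · intro h
    have hne : Nonempty V(H) := h.nonempty
    refine ⟨Set.nonempty_coe_sort.1 hne, ?_⟩
    rintro T ⟨v, hv, hvT⟩ hT w hw
    obtain ⟨p⟩ := h.preconnected ⟨v, hv⟩ ⟨w, hw⟩
    have key : ∀ (a b : V(H)) (p : H.toSimpleGraph.Walk a b), (a : α) ∈ T → (b : α) ∈ T := by
      intro a b p
      induction p with
      | nil => exact id
      | cons hadj _ ih =>
        intro ha
        obtain ⟨-, e, he⟩ := hadj
        exact ih (hT e _ _ he ha)
    exact key _ _ p hvT
  · rintro ⟨⟨v, hv⟩, h⟩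
    have : Nonempty V(H) := ⟨⟨v, hv⟩⟩
    refine ⟨fun a b => ?_⟩
    have := h {x | ∃ hx : x ∈ V(H), H.toSimpleGraph.Reachable a ⟨x, hx⟩}
      ⟨a, a.2, a.2, SimpleGraph.Reachable.refl _⟩ (by
        rintro e x y hxy ⟨hx, hr⟩
        refine ⟨hxy.right_mem, hr.trans ?_⟩
        by_cases hne : x = y
        · subst hne; exact SimpleGraph.Reachable.refl _
        · refine SimpleGraph.Adj.reachable ⟨?_, e, hxy⟩
          simpa using hne) b.2
    exact this.2

/-! ### Oriented edges -/

@[simp] theorem Arrow.rev_edge (a : Arrow G) : a.rev.edge = a.edge := rfl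
@[simp] theorem Arrow.rev_tail (a : Arrow G) : a.rev.tail = a.head := rfl
@[simp] theorem Arrow.rev_head (a : Arrow G) : a.rev.head = a.tail := rfl
@[simp] theorem Arrow.rev_rev (a : Arrow G) : a.rev.rev = a := rfl

theorem Arrow.edge_mem (a : Arrow G) : a.edge ∈ E(G) := a.isLink.edge_mem

theorem Arrow.eq_or_eq_rev {a b : Arrow G} (h : a.edge = b.edge) : a = b ∨ a = b.rev := by
  have h' := a.isLink
  rw [h] at h'
  rcases h'.eq_and_eq_or_eq_and_eq b.isLink with ⟨h1, h2⟩ | ⟨h1, h2⟩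
  · exact Or.inl (Arrow.ext h (Subtype.ext h1) (Subtype.ext h2))
  · exact Or.inr (Arrow.ext h (Subtype.ext h1) (Subtype.ext h2))

theorem Arrow.finite [Finite V(G)] [Finite E(G)] : Finite (Arrow G) :=
  Finite.of_injective
    (fun a : Arrow G => ((⟨a.edge, a.edge_mem⟩ : E(G)), a.tail, a.head)) (by
      intro a b h
      simp only [Prod.mk.injEq, Subtype.mk.injEq] at h
      exact Arrow.ext h.1 h.2.1 h.2.2)

/-- The permutation of the oriented edges that reverses orientations. -/
def revEquiv (G : Graph α β) : Arrow G ≃ Arrow G where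
  toFun := Arrow.rev
  invFun := Arrow.rev
  left_inv _ := rfl
  right_inv _ := rfl

theorem C1.apply_rev (x : C1 G) (a : Arrow G) : x.1 a.rev = -x.1 a := x.2 a

/-- The difference `f(v) - f(u)` along an oriented edge `uv`. -/
def grad {R : Type*} [Sub R] (f : V(G) → R) (a : Arrow G) : R := f a.head - f a.tail

theorem grad_rev {R : Type*} [AddGroup R] (f : V(G) → R) (a : Arrow G) :
    grad f a.rev = -grad f a := by simp [grad]

theorem delta_eq (a : Arrow G) : delta ℓ f a = grad f a / (ℓ a.edge : ℤ) := rfl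

/-! ### The subgraph of a function -/

theorem mem_edgeSet_subgraphOf {a : Arrow G} :
    a.edge ∈ E(subgraphOf G ℓ f) ↔ (ℓ a.edge : ℤ) ∣ grad f a := by
  constructor
  · rintro ⟨-, b, hb, hd⟩
    rcases Arrow.eq_or_eq_rev hb with rfl | rfl
    · exact hd
    · have := (dvd_neg (a := (ℓ a.edge : ℤ))).2 hd
      simpa [grad] using this
  · intro h
    exact ⟨a.edge_mem, a, rfl, h⟩

theorem isLink_subgraphOf {e : β} {x y : α} :
    (subgraphOf G ℓ f).IsLink e x y ↔
      ∃ a : Arrow G, a.edge = e ∧ (a.tail : α) = x ∧ (a.head : α) = y ∧ (ℓ e : ℤ) ∣ grad f a := by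
  constructor
  · rintro ⟨h1, h2⟩
    refine ⟨⟨e, ⟨x, h2.left_mem⟩, ⟨y, h2.right_mem⟩, h2⟩, rfl, rfl, rfl, ?_⟩
    exact (mem_edgeSet_subgraphOf (a := ⟨e, ⟨x, h2.left_mem⟩, ⟨y, h2.right_mem⟩, h2⟩)).1
      ⟨h2.edge_mem, h1⟩
  · rintro ⟨a, rfl, rfl, rfl, hd⟩
    exact ⟨(mem_edgeSet_subgraphOf.2 hd).2, a.isLink⟩

/-- This form avoids walks: to see that a function is constant on a connected subgraph, take T to be
one of its level sets. -/
theorem connected_subgraphOf_iff :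
    Connected (subgraphOf G ℓ f) ↔ V(G).Nonempty ∧ ∀ T : Set α, (∃ v ∈ V(G), v ∈ T) →
      (∀ a : Arrow G, (ℓ a.edge : ℤ) ∣ grad f a → (a.tail : α) ∈ T → (a.head : α) ∈ T) →
        V(G) ⊆ T := by
  rw [connected_iff_forall_closed]
  refine and_congr Iff.rfl (forall_congr' fun T => imp_congr Iff.rfl (imp_congr ?_ Iff.rfl))
  constructor
  · intro h a hd ht
    exact h a.edge _ _ (isLink_subgraphOf.2 ⟨a, rfl, rfl, rfl, hd⟩) ht
  · intro h e x y hl hx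
    obtain ⟨a, rfl, rfl, rfl, hd⟩ := isLink_subgraphOf.1 hl
    exact h a hd hx

theorem connected_induce_subgraphOf_iff :
    Connected ((subgraphOf G ℓ f).induce S) ↔ S.Nonempty ∧ ∀ T : Set α, (∃ v ∈ S, v ∈ T) →
      (∀ a : Arrow G, (ℓ a.edge : ℤ) ∣ grad f a → (a.tail : α) ∈ S → (a.head : α) ∈ S →
        (a.tail : α) ∈ T → (a.head : α) ∈ T) → S ⊆ T := by
  rw [connected_iff_forall_closed]
  refine and_congr Iff.rfl (forall_congr' fun T => imp_congr Iff.rfl (imp_congr ?_ Iff.rfl))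
  constructor
  · intro h a hd hs hs' ht
    exact h a.edge _ _ ⟨isLink_subgraphOf.2 ⟨a, rfl, rfl, rfl, hd⟩, hs, hs'⟩ ht
  · rintro h e x y ⟨hl, hx, hy⟩ hxT
    obtain ⟨a, rfl, rfl, rfl, hd⟩ := isLink_subgraphOf.1 hl
    exact h a hd hx hy hxT

theorem eq_of_connected_of_grad_eq_zero {R : Type*} [AddGroup R] {ψ : V(G) → R}
    (hf : Connected (subgraphOf G ℓ f))
    (h : ∀ a : Arrow G, (ℓ a.edge : ℤ) ∣ grad f a → grad ψ a = 0) (v w : V(G)) : ψ v = ψ w := by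
  have := (connected_subgraphOf_iff.1 hf).2 {x | ∃ hx : x ∈ V(G), ψ ⟨x, hx⟩ = ψ w}
    ⟨w, w.2, w.2, rfl⟩ (by
      rintro a hd ⟨_, ht⟩
      exact ⟨a.head.2, (sub_eq_zero.1 (h a hd)).trans ht⟩) v.2
  exact this.2

theorem eq_of_connected_induce_of_grad_eq_zero {R : Type*} [AddGroup R] {ψ : V(G) → R}
    (hf : Connected ((subgraphOf G ℓ f).induce S))
    (h : ∀ a : Arrow G, (ℓ a.edge : ℤ) ∣ grad f a → (a.tail : α) ∈ S → (a.head : α) ∈ S →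
      grad ψ a = 0) {v w : V(G)} (hv : (v : α) ∈ S) (hw : (w : α) ∈ S) : ψ v = ψ w := by
  have := (connected_induce_subgraphOf_iff.1 hf).2 {x | ∃ hx : x ∈ V(G), ψ ⟨x, hx⟩ = ψ w}
    ⟨w, hw, w.2, rfl⟩ (by
      rintro a hd hs hs' ⟨_, ht⟩
      exact ⟨a.head.2, (sub_eq_zero.1 (h a hd hs hs')).trans ht⟩) hv
  exact this.2

/-! ### The cube of a function -/

/-- The largest value at an oriented edge that points of the cube `□_f` have. -/
def hi (ℓ : β → ℕ) (f : V(G) → ℤ) (a : Arrow G) : ℝ := delta ℓ f a + 1 / 2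

theorem neg_ediv_of_not_dvd {D m : ℤ} (hm : 0 < m) (h : ¬ m ∣ D) : -D / m = -(D / m) - 1 := by
  have h1 := Int.emod_add_mul_ediv D m
  have h2 := Int.emod_nonneg D hm.ne'
  have h3 := Int.emod_lt_of_pos D hm
  have h4 : D % m ≠ 0 := fun h0 => h (Int.dvd_of_emod_eq_zero h0)
  have h5 : 0 < D % m := lt_of_le_of_ne h2 (Ne.symm h4)
  rw [Int.ediv_eq_iff_of_pos hm]
  constructor <;> nlinarith

theorem delta_rev_of_dvd {a : Arrow G} (h : (ℓ a.edge : ℤ) ∣ grad f a) :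
    delta ℓ f a.rev = -delta ℓ f a := by
  rw [delta_eq, delta_eq, grad_rev, Arrow.rev_edge, Int.neg_ediv_of_dvd h]

theorem delta_rev_of_not_dvd {a : Arrow G} (hℓ : ∀ e ∈ E(G), 0 < ℓ e)
    (h : ¬ (ℓ a.edge : ℤ) ∣ grad f a) : delta ℓ f a.rev = -delta ℓ f a - 1 := by
  rw [delta_eq, delta_eq, grad_rev, Arrow.rev_edge,
    neg_ediv_of_not_dvd (by exact_mod_cast hℓ _ a.edge_mem) h]

theorem hi_add_hi_rev_of_dvd {a : Arrow G} (h : (ℓ a.edge : ℤ) ∣ grad f a) :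
    hi ℓ f a + hi ℓ f a.rev = 1 := by
  rw [hi, hi, delta_rev_of_dvd h]; push_cast; ring

theorem hi_add_hi_rev_of_not_dvd {a : Arrow G} (hℓ : ∀ e ∈ E(G), 0 < ℓ e)
    (h : ¬ (ℓ a.edge : ℤ) ∣ grad f a) : hi ℓ f a + hi ℓ f a.rev = 0 := by
  rw [hi, hi, delta_rev_of_not_dvd hℓ h]; push_cast; ring

theorem dPoint_eq_hi (a : Arrow G) : (dPoint ℓ f).1 a = (hi ℓ f a - hi ℓ f a.rev) / 2 := by
  simp only [dPoint, hi]; ring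

/-- The bounds at a and ā confine x(a) to an interval centred at 𝔡_f(a), of length 1 on G_f and of
length 0 off it. -/
theorem mem_cube_iff (hℓ : ∀ e ∈ E(G), 0 < ℓ e) {x : C1 G} :
    x ∈ cube G ℓ f ↔ ∀ a, x.1 a ≤ hi ℓ f a := by
  constructor
  · rintro ⟨ε, h1, h2, rfl⟩ a
    change (dPoint ℓ f).1 a + ε.1 a ≤ _
    rw [dPoint_eq_hi]
    by_cases hd : (ℓ a.edge : ℤ) ∣ grad f a
    · have := hi_add_hi_rev_of_dvd hd
      have := (abs_le.1 (h1 a)).2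
      linarith
    · have := hi_add_hi_rev_of_not_dvd hℓ hd
      rw [h2 a (fun h => hd (mem_edgeSet_subgraphOf.1 h))]
      linarith
  · intro h
    have key : ∀ a, (x - dPoint ℓ f).1 a = x.1 a - (hi ℓ f a - hi ℓ f a.rev) / 2 := by
      intro a
      rw [← dPoint_eq_hi]; rfl
    refine ⟨x - dPoint ℓ f, fun a => ?_, fun a ha => ?_, by abel⟩
    · rw [key, abs_le]
      have h1 := h a
      have h2 := h a.rev
      rw [C1.apply_rev] at h2
      by_cases hd : (ℓ a.edge : ℤ) ∣ grad f a
      · have := hi_add_hi_rev_of_dvd hd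
        constructor <;> linarith
      · have := hi_add_hi_rev_of_not_dvd hℓ hd
        constructor <;> linarith
    · rw [key]
      have h1 := h a
      have h2 := h a.rev
      rw [C1.apply_rev] at h2
      have := hi_add_hi_rev_of_not_dvd hℓ (fun hd => ha (mem_edgeSet_subgraphOf.2 hd))
      linarith

theorem hi_add_hi_rev_nonneg (hℓ : ∀ e ∈ E(G), 0 < ℓ e) (a : Arrow G) :
    0 ≤ hi ℓ f a + hi ℓ f a.rev := by
  by_cases hd : (ℓ a.edge : ℤ) ∣ grad f a
  · rw [hi_add_hi_rev_of_dvd hd]; exact zero_le_one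
  · rw [hi_add_hi_rev_of_not_dvd hℓ hd]

/-! ### The pairing of functions on vertices -/

section Pairing

variable [Fintype V(G)] [Fintype (Arrow G)]

theorem dotProduct_dStar (φ : V(G) → ℝ) (x : C1 G) :
    φ ⬝ᵥ dStar x = ∑ a, φ a.head * x.1 a := by
  classical
  have h1 : ∀ v, dStar x v = ∑ a : Arrow G with a.head = v, x.1 a := by
    intro v
    rw [dStar, finsum_eq_sum_of_fintype]
    exact (Finset.sum_subtype (Finset.univ.filter fun a : Arrow G => a.head = v)
      (fun a => by simp) (fun a => x.1 a)).symm
  rw [← Finset.sum_fiberwise Finset.univ (fun a : Arrow G => a.head)]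
  simp only [dotProduct, h1, Finset.mul_sum]
  refine Finset.sum_congr rfl fun v _ => Finset.sum_congr rfl fun a ha => ?_
  rw [(Finset.mem_filter.1 ha).2]

theorem dotProduct_dStar_eq_sum_grad (φ : V(G) → ℝ) (x : C1 G) :
    φ ⬝ᵥ dStar x = (∑ a, grad φ a * x.1 a) / 2 := by
  have h : ∑ a, φ a.head * x.1 a = ∑ a, -(φ a.tail * x.1 a) := by
    refine Fintype.sum_equiv (revEquiv G) _ _ fun a => ?_
    change _ = -(φ a.head * x.1 a.rev)
    rw [C1.apply_rev]; ring
  have h2 : ∑ a, grad φ a * x.1 a = ∑ a, φ a.head * x.1 a + ∑ a, -(φ a.tail * x.1 a) := by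
    rw [← Finset.sum_add_distrib]
    exact Finset.sum_congr rfl fun a _ => by rw [grad]; ring
  rw [h2, ← h, dotProduct_dStar]; ring

/-- The two orientations of an edge contribute equally to Σ grad φ · x. Keeping the increasing one
makes all coefficients non-negative, so upper bounds on x can be applied term by term. -/
theorem dotProduct_dStar_eq_sum_max (φ : V(G) → ℝ) (x : C1 G) :
    φ ⬝ᵥ dStar x = ∑ a, max (grad φ a) 0 * x.1 a := by
  have h : ∑ a, max (grad φ a) 0 * x.1 a = ∑ a, -(max (-grad φ a) 0 * x.1 a) := by
    refine Fintype.sum_equiv (revEquiv G) _ _ fun a => ?_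
    change _ = -(max (-grad φ a.rev) 0 * x.1 a.rev)
    rw [C1.apply_rev, grad_rev, neg_neg]; ring
  have h2 : ∑ a, grad φ a * x.1 a =
      ∑ a, max (grad φ a) 0 * x.1 a + ∑ a, -(max (-grad φ a) 0 * x.1 a) := by
    rw [← Finset.sum_add_distrib]
    refine Finset.sum_congr rfl fun a _ => ?_
    rcases le_total (grad φ a) 0 with h0 | h0
    · rw [max_eq_right h0, max_eq_left (by linarith)]; ring
    · rw [max_eq_left h0, max_eq_right (by linarith)]; ring
  rw [dotProduct_dStar_eq_sum_grad, h2, ← h]; ring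

end Pairing

/-! ### Faces of the polytopes -/

/-- The points of the cube `□_f` that are extremal on all oriented edges along which `φ`
increases. -/
def cubeFace (ℓ : β → ℕ) (f : V(G) → ℤ) (φ : V(G) → ℝ) : Set (C1 G) :=
  {x | ∀ a, x.1 a ≤ hi ℓ f a ∧ (0 < grad φ a → x.1 a = hi ℓ f a)}

/-- The face of `Vor_{G,ℓ}(f)` on which the functional given by `φ` is maximal. -/
def face (ℓ : β → ℕ) (f : V(G) → ℤ) (φ : V(G) → ℝ) : Set (V(G) → ℝ) :=
  dStar '' cubeFace ℓ f φ

/-- The middle point of a face of the cube `□_f`. -/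
def facePoint (ℓ : β → ℕ) (f : V(G) → ℤ) (φ : V(G) → ℝ) : C1 G :=
  ⟨fun a => if 0 < grad φ a then hi ℓ f a else if grad φ a < 0 then -hi ℓ f a.rev
    else (hi ℓ f a - hi ℓ f a.rev) / 2, fun a => by
    simp only [grad_rev, Arrow.rev_rev, Left.neg_pos_iff, Left.neg_neg_iff]
    rcases lt_trichotomy (grad φ a) 0 with h | h | h
    · simp [h, h.not_gt]
    · simp [h]; ring
    · simp [h, h.not_gt]⟩

theorem facePoint_mem (hℓ : ∀ e ∈ E(G), 0 < ℓ e) (φ : V(G) → ℝ) :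
    facePoint ℓ f φ ∈ cubeFace ℓ f φ := by
  intro a
  have := hi_add_hi_rev_nonneg (f := f) hℓ a
  simp only [facePoint]
  refine ⟨?_, fun h => if_pos h⟩
  split_ifs <;> linarith

theorem facePoint_of_grad_eq_zero {φ : V(G) → ℝ} {a : Arrow G} (h : grad φ a = 0) :
    (facePoint ℓ f φ).1 a = (hi ℓ f a - hi ℓ f a.rev) / 2 := by
  simp [facePoint, h]

theorem face_nonempty (hℓ : ∀ e ∈ E(G), 0 < ℓ e) (φ : V(G) → ℝ) : (face ℓ f φ).Nonempty :=
  ⟨_, _, facePoint_mem hℓ φ, rfl⟩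

theorem face_congr {φ ψ : V(G) → ℝ} (h : ∀ a, 0 < grad φ a ↔ 0 < grad ψ a) :
    face ℓ f φ = face ℓ f ψ := by
  simp only [face, cubeFace, h]

theorem cubeFace_subset_cube (hℓ : ∀ e ∈ E(G), 0 < ℓ e) (φ : V(G) → ℝ) :
    cubeFace ℓ f φ ⊆ cube G ℓ f := fun _ hx => (mem_cube_iff hℓ).2 fun a => (hx a).1

theorem face_subset_Vor (hℓ : ∀ e ∈ E(G), 0 < ℓ e) (φ : V(G) → ℝ) :
    face ℓ f φ ⊆ Vor G ℓ f := Set.image_mono (cubeFace_subset_cube hℓ φ)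

theorem face_eq_Vor (hℓ : ∀ e ∈ E(G), 0 < ℓ e) {φ : V(G) → ℝ} (h : ∀ v w, φ v = φ w) :
    face ℓ f φ = Vor G ℓ f := by
  refine (face_subset_Vor hℓ φ).antisymm (Set.image_mono fun x hx a => ?_)
  refine ⟨(mem_cube_iff hℓ).1 hx a, fun ha => ?_⟩
  rw [grad, h a.head a.tail, sub_self] at ha
  exact absurd ha (lt_irrefl _)

/-! ### The dimension of a face -/

/-- The functions on vertices that are constant along the edges of `G_f` along which `φ` is
constant. -/
def levelFunctions (ℓ : β → ℕ) (f : V(G) → ℤ) (φ : V(G) → ℝ) : Submodule ℝ (V(G) → ℝ) where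
  carrier := {ψ | ∀ a : Arrow G, (ℓ a.edge : ℤ) ∣ grad f a → grad φ a = 0 → grad ψ a = 0}
  zero_mem' := fun a _ _ => by simp [grad]
  add_mem' := fun {ψ χ} hψ hχ a h h' => by
    have h1 : ψ a.head - ψ a.tail = 0 := hψ a h h'
    have h2 : χ a.head - χ a.tail = 0 := hχ a h h'
    simp only [grad, Pi.add_apply]; linarith
  smul_mem' := fun c ψ hψ a h h' => by
    have h1 : ψ a.head - ψ a.tail = 0 := hψ a h h'
    simp only [grad, Pi.smul_apply, smul_eq_mul, ← mul_sub, h1, mul_zero]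

/-- The function `1` on an oriented edge, `-1` on the reverse one, and `0` elsewhere. -/
def arrowFunction (a : Arrow G) : C1 G :=
  open Classical in
  ⟨fun b => (if b = a then 1 else 0) - (if b.rev = a then 1 else 0), fun _ => (neg_sub _ _).symm⟩

theorem finrank_H0_add_one [Fintype V(G)] [Nonempty V(G)] :
    Module.finrank ℝ (H0 G) + 1 = Fintype.card V(G) := by
  classical
  let l : (V(G) → ℝ) →ₗ[ℝ] ℝ := dotProductEquiv ℝ V(G) 1
  have h1 : H0 G = LinearMap.ker l := by
    ext y
    rw [LinearMap.mem_ker]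
    change ∑ᶠ v, y v = 0 ↔ (1 : V(G) → ℝ) ⬝ᵥ y = 0
    rw [finsum_eq_sum_of_fintype, one_dotProduct]
  have h2 : LinearMap.range l = ⊤ := by
    rw [LinearMap.range_eq_top]
    obtain ⟨v⟩ := ‹Nonempty V(G)›
    refine fun c => ⟨Pi.single v c, ?_⟩
    change (1 : V(G) → ℝ) ⬝ᵥ Pi.single v c = c
    simp
  have h3 := l.finrank_range_add_finrank_ker
  rw [h2, finrank_top, Module.finrank_self, Module.finrank_fintype_fun_eq_card] at h3
  rw [h1]; omega

/-! ### Exposed faces and their directions -/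

section Pairing

variable [Fintype V(G)] [Fintype (Arrow G)]

theorem dotProduct_dStar_le {x : C1 G} (hx : ∀ a, x.1 a ≤ hi ℓ f a) (φ : V(G) → ℝ) :
    φ ⬝ᵥ dStar x ≤ ∑ a, max (grad φ a) 0 * hi ℓ f a := by
  rw [dotProduct_dStar_eq_sum_max]
  exact Finset.sum_le_sum fun a _ => mul_le_mul_of_nonneg_left (hx a) (le_max_right _ _)

theorem dotProduct_dStar_eq_iff {x : C1 G} (hx : ∀ a, x.1 a ≤ hi ℓ f a) (φ : V(G) → ℝ) :
    φ ⬝ᵥ dStar x = ∑ a, max (grad φ a) 0 * hi ℓ f a ↔ x ∈ cubeFace ℓ f φ := by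
  rw [dotProduct_dStar_eq_sum_max, Finset.sum_eq_sum_iff_of_le
    fun a _ => mul_le_mul_of_nonneg_left (hx a) (le_max_right _ _)]
  refine ⟨fun h a => ⟨hx a, fun ha => ?_⟩, fun h a _ => ?_⟩
  · have := h a (Finset.mem_univ a)
    rw [max_eq_left ha.le] at this
    exact mul_left_cancel₀ ha.ne' this
  · rcases le_or_gt (grad φ a) 0 with h0 | h0
    · rw [max_eq_right h0]; simp
    · rw [(h a).2 h0]

/-- Although `dStar` need not be injective, extremality of x is equivalent to φ attaining its bound,
and this depends on `dStar x` alone. -/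
theorem dStar_mem_face_iff {x : C1 G} (hx : ∀ a, x.1 a ≤ hi ℓ f a) (φ : V(G) → ℝ) :
    dStar x ∈ face ℓ f φ ↔ x ∈ cubeFace ℓ f φ := by
  refine ⟨?_, fun h => ⟨x, h, rfl⟩⟩
  rintro ⟨y, hy, hyx⟩
  rw [← dotProduct_dStar_eq_iff hx, ← hyx, dotProduct_dStar_eq_iff fun a => (hy a).1]
  exact hy

theorem face_eq_setOf (hℓ : ∀ e ∈ E(G), 0 < ℓ e) (φ : V(G) → ℝ) :
    face ℓ f φ = {y ∈ Vor G ℓ f | ∀ z ∈ Vor G ℓ f, φ ⬝ᵥ z ≤ φ ⬝ᵥ y} := by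
  ext y
  constructor
  · intro hy
    refine ⟨face_subset_Vor hℓ φ hy, ?_⟩
    rintro _ ⟨x, hx, rfl⟩
    obtain ⟨x', hx', rfl⟩ := hy
    rw [(dotProduct_dStar_eq_iff (fun a => (hx' a).1) φ).2 hx']
    exact dotProduct_dStar_le ((mem_cube_iff hℓ).1 hx) φ
  · rintro ⟨⟨x, hx, rfl⟩, hmax⟩
    have hx' := (mem_cube_iff hℓ).1 hx
    rw [dStar_mem_face_iff hx', ← dotProduct_dStar_eq_iff hx']
    refine (dotProduct_dStar_le hx' φ).antisymm ?_
    have hp := facePoint_mem (f := f) hℓ φ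
    rw [← (dotProduct_dStar_eq_iff (fun a => (hp a).1) φ).2 hp]
    exact hmax _ (Set.mem_image_of_mem _ (cubeFace_subset_cube hℓ φ hp))

theorem nonempty_and_isExposed_iff (hℓ : ∀ e ∈ E(G), 0 < ℓ e) {σ : Set (V(G) → ℝ)} :
    σ.Nonempty ∧ IsExposed ℝ (Vor G ℓ f) σ ↔ ∃ φ, σ = face ℓ f φ := by
  classical
  constructor
  · rintro ⟨hne, h⟩
    obtain ⟨l, hl⟩ := h hne
    refine ⟨(dotProductEquiv ℝ V(G)).symm l.toLinearMap, ?_⟩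
    have key : ∀ y, (dotProductEquiv ℝ V(G)).symm l.toLinearMap ⬝ᵥ y = l y := by
      intro y
      rw [← dotProductEquiv_apply_apply, LinearEquiv.apply_symm_apply]
      rfl
    rw [hl, face_eq_setOf hℓ]
    simp only [key]
  · rintro ⟨φ, rfl⟩
    refine ⟨face_nonempty hℓ φ, fun _ =>
      ⟨LinearMap.toContinuousLinearMap (dotProductEquiv ℝ V(G) φ), ?_⟩⟩
    rw [face_eq_setOf hℓ]
    rfl

theorem dotProduct_dStar_add_smul_arrowFunction (ψ : V(G) → ℝ) (x : C1 G) (c : ℝ) (a : Arrow G) :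
    ψ ⬝ᵥ dStar (x + c • arrowFunction a) = ψ ⬝ᵥ dStar x + c * grad ψ a := by
  classical
  have h : ∑ b, grad ψ b * (arrowFunction a).1 b = 2 * grad ψ a := by
    have h3 : ∀ b : Arrow G, b.rev = a ↔ b = a.rev := fun b =>
      ⟨fun h => by rw [← h, Arrow.rev_rev], fun h => by rw [h, Arrow.rev_rev]⟩
    simp only [arrowFunction, mul_sub, Finset.sum_sub_distrib, h3,
      mul_ite, mul_one, mul_zero, Finset.sum_ite_eq', Finset.mem_univ, if_true, grad_rev]
    ring
  have h2 : ∀ b, (x + c • arrowFunction a).1 b = x.1 b + c * (arrowFunction a).1 b := fun _ => rfl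
  simp only [dotProduct_dStar_eq_sum_grad, h2, mul_add, Finset.sum_add_distrib]
  simp only [mul_left_comm _ c, ← Finset.mul_sum, h]
  ring

/-- On the cube face, x(a) is fixed off G_f and wherever φ changes; the remaining coordinates are
free, and must be invisible to ψ. -/
theorem mem_levelFunctions_iff_const [G.Loopless] (hℓ : ∀ e ∈ E(G), 0 < ℓ e) {φ ψ : V(G) → ℝ} :
    ψ ∈ levelFunctions ℓ f φ ↔
      ∀ y ∈ face ℓ f φ, ∀ z ∈ face ℓ f φ, ψ ⬝ᵥ y = ψ ⬝ᵥ z := by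
  constructor
  · rintro h _ ⟨x, hx, rfl⟩ _ ⟨y, hy, rfl⟩
    rw [dotProduct_dStar_eq_sum_grad, dotProduct_dStar_eq_sum_grad]
    congr 1
    refine Finset.sum_congr rfl fun a _ => ?_
    by_cases hd : (ℓ a.edge : ℤ) ∣ grad f a
    · rcases lt_trichotomy (grad φ a) 0 with h0 | h0 | h0
      · have h1 : 0 < grad φ a.rev := by rw [grad_rev]; linarith
        have h2 := (hx a.rev).2 h1
        rw [← (hy a.rev).2 h1, C1.apply_rev, C1.apply_rev] at h2
        rw [neg_injective h2]
      · rw [h a hd h0, zero_mul, zero_mul]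
      · rw [(hx a).2 h0, (hy a).2 h0]
    · have key : ∀ x ∈ cubeFace ℓ f φ, x.1 a = hi ℓ f a := by
        intro x hx
        have h1 := (hx a).1
        have h2 := (hx a.rev).1
        rw [C1.apply_rev] at h2
        have := hi_add_hi_rev_of_not_dvd hℓ hd
        linarith
      rw [key x hx, key y hy]
  · intro h a hd h0
    have hp := facePoint_mem (f := f) hℓ φ
    -- At the midpoint the free coordinate a has slack exactly 1/2. Moving by that amount changes
    -- the pairing with ψ by half of grad ψ(a).
    have hq : facePoint ℓ f φ + (1 / 2 : ℝ) • arrowFunction a ∈ cubeFace ℓ f φ := by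
      classical
      intro b
      have h2 : (facePoint ℓ f φ + (1 / 2 : ℝ) • arrowFunction a).1 b =
        (facePoint ℓ f φ).1 b + (1 / 2) * (arrowFunction a).1 b := rfl
      -- A loop would be its own reverse, and its `arrowFunction` would vanish.
      have hne : a ≠ a.rev := by
        intro hab
        have h3 : (a.tail : α) = a.head := congrArg (fun b => (b.tail : α)) hab
        have h4 := a.isLink
        exact h4.ne h3
      rw [h2]
      by_cases hba : b = a
      · subst hba
        have h3 : (arrowFunction b).1 b = 1 := by simp [arrowFunction, hne.symm]
        have h4 := hi_add_hi_rev_of_dvd hd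
        rw [h3, facePoint_of_grad_eq_zero h0]
        exact ⟨by linarith, fun h5 => absurd h0 h5.ne'⟩
      by_cases hba' : b = a.rev
      · subst hba'
        have h3 : (arrowFunction a).1 a.rev = -1 := by
          simp [arrowFunction, hne.symm]
        have h4 := hi_add_hi_rev_of_dvd hd
        have h5 : grad φ a.rev = 0 := by rw [grad_rev, h0, neg_zero]
        rw [h3, facePoint_of_grad_eq_zero h5, Arrow.rev_rev]
        exact ⟨by linarith, fun h6 => absurd h5 h6.ne'⟩
      · have h3 : (arrowFunction a).1 b = 0 := by
          have hba2 : b.rev ≠ a := fun h => hba' (by rw [← h, Arrow.rev_rev])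
          simp [arrowFunction, hba, hba2]
        rw [h3, mul_zero, add_zero]
        exact hp b
    have := h _ ⟨_, hq, rfl⟩ _ ⟨_, hp, rfl⟩
    rw [dotProduct_dStar_add_smul_arrowFunction] at this
    linarith

/-- Under the dot product, the level functions are the annihilator of the direction space of the
face. -/
theorem finrank_vectorSpan_face_add [G.Loopless] (hℓ : ∀ e ∈ E(G), 0 < ℓ e) (φ : V(G) → ℝ) :
    Module.finrank ℝ (vectorSpan ℝ (face ℓ f φ)) + Module.finrank ℝ (levelFunctions ℓ f φ) =
      Fintype.card V(G) := by
  classical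
  have h : (levelFunctions ℓ f φ).map (dotProductEquiv ℝ V(G)).toLinearMap =
      (vectorSpan ℝ (face ℓ f φ)).dualAnnihilator := by
    ext l
    obtain ⟨ψ, rfl⟩ := (dotProductEquiv ℝ V(G)).surjective l
    rw [Submodule.mem_map_equiv, LinearEquiv.symm_apply_apply,
      mem_levelFunctions_iff_const hℓ, Submodule.mem_dualAnnihilator]
    constructor
    · intro h w hw
      induction hw using Submodule.span_induction with
      | mem w hw =>
        obtain ⟨y, hy, z, hz, rfl⟩ := Set.mem_vsub.1 hw
        rw [vsub_eq_sub, map_sub, dotProductEquiv_apply_apply, dotProductEquiv_apply_apply,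
          h y hy z hz, sub_self]
      | zero => exact map_zero _
      | add x y _ _ hx hy => rw [map_add, hx, hy, add_zero]
      | smul c x _ hx => rw [map_smul, hx, smul_zero]
    · intro h y hy z hz
      have := h _ (vsub_mem_vectorSpan ℝ hy hz)
      rw [vsub_eq_sub, map_sub, dotProductEquiv_apply_apply, dotProductEquiv_apply_apply] at this
      linarith
  have h2 := Subspace.finrank_add_finrank_dualAnnihilator_eq (vectorSpan ℝ (face ℓ f φ))
  rw [← h, LinearEquiv.finrank_map_eq, Module.finrank_fintype_fun_eq_card] at h2
  exact h2

/-- The extra 1 accounts for the constants, which annihilate H₀. -/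
theorem mem_cellsOfCodim_iff [G.Loopless] [Nonempty V(G)] (hℓ : ∀ e ∈ E(G), 0 < ℓ e) {k : ℕ}
    {σ : Set (V(G) → ℝ)} : σ ∈ cellsOfCodim G ℓ k ↔
      ∃ f φ, Connected (subgraphOf G ℓ f) ∧ σ = face ℓ f φ ∧
        Module.finrank ℝ (levelFunctions ℓ f φ) = k + 1 := by
  have h0 := finrank_H0_add_one (G := G)
  constructor
  · rintro ⟨⟨hne, f, hf, hσ⟩, hk⟩
    obtain ⟨φ, rfl⟩ := (nonempty_and_isExposed_iff hℓ).1 ⟨hne, hσ⟩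
    have := finrank_vectorSpan_face_add (f := f) hℓ φ
    exact ⟨f, φ, hf, rfl, by omega⟩
  · rintro ⟨f, φ, hf, rfl, hk⟩
    have := finrank_vectorSpan_face_add (f := f) hℓ φ
    obtain ⟨h1, h2⟩ := (nonempty_and_isExposed_iff (f := f) hℓ).2 ⟨φ, rfl⟩
    exact ⟨⟨h1, f, hf, h2⟩, by omega⟩

end Pairing

/-! ### Cuts -/

/-- The characteristic function of a set of vertices. -/
def chi (G : Graph α β) (S : Set α) : V(G) → ℝ := fun v => S.indicator 1 (v : α)

theorem chi_of_mem {v : V(G)} (h : (v : α) ∈ S) : chi G S v = 1 := by simp [chi, h]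

theorem chi_of_notMem {v : V(G)} (h : (v : α) ∉ S) : chi G S v = 0 := by simp [chi, h]

theorem chi_eq_one_iff {v : V(G)} : chi G S v = 1 ↔ (v : α) ∈ S := by
  by_cases h : (v : α) ∈ S <;> simp [chi, h]

/-- An oriented edge enters `S` if its head is in `S` and its tail is not. -/
def Arrow.Enters (a : Arrow G) (S : Set α) : Prop := (a.tail : α) ∉ S ∧ (a.head : α) ∈ S

theorem grad_chi_pos_iff {a : Arrow G} : 0 < grad (chi G S) a ↔ a.Enters S := by
  by_cases h : (a.tail : α) ∈ S <;> by_cases h' : (a.head : α) ∈ S <;>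
    simp [grad, chi, Arrow.Enters, h, h']

theorem grad_chi_eq_zero_iff {a : Arrow G} :
    grad (chi G S) a = 0 ↔ ((a.tail : α) ∈ S ↔ (a.head : α) ∈ S) := by
  by_cases h : (a.tail : α) ∈ S <;> by_cases h' : (a.head : α) ∈ S <;> simp [grad, chi, h, h']

theorem enters_sdiff_iff {a : Arrow G} : a.Enters (V(G) \ S) ↔ a.rev.Enters S := by
  simp [Arrow.Enters, and_comm]

theorem mem_cubeFace_chi {x : C1 G} : x ∈ cubeFace ℓ f (chi G S) ↔
    ∀ a, x.1 a ≤ hi ℓ f a ∧ (a.Enters S → x.1 a = hi ℓ f a) := by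
  simp only [cubeFace, grad_chi_pos_iff]; rfl

/-- The subset `S` of `V` is proper and non-empty, and the subgraphs of `G_f` induced on `S` and on
its complement are connected, as is `G_f` itself. -/
structure IsBond (ℓ : β → ℕ) (f : V(G) → ℤ) (S : Set α) : Prop where
  connected : Connected (subgraphOf G ℓ f)
  ssubset : S ⊂ V(G)
  connected_induce : Connected ((subgraphOf G ℓ f).induce S)
  connected_induce_compl : Connected ((subgraphOf G ℓ f).induce (V(G) \ S))

theorem IsBond.compl (h : IsBond ℓ f S) : IsBond ℓ f (V(G) \ S) := by
  have hS : V(G) \ (V(G) \ S) = S := Set.sdiff_sdiff_cancel_left h.ssubset.subset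
  refine ⟨h.connected, ?_, h.connected_induce_compl, by rw [hS]; exact h.connected_induce⟩
  obtain ⟨v, hv⟩ := (connected_induce_subgraphOf_iff.1 h.connected_induce).1
  exact ⟨Set.sdiff_subset, fun h' => (h' (h.ssubset.subset hv)).2 hv⟩

theorem IsBond.exists_mem (h : IsBond ℓ f S) : ∃ v : V(G), (v : α) ∈ S := by
  obtain ⟨v, hv⟩ := (connected_induce_subgraphOf_iff.1 h.connected_induce).1
  exact ⟨⟨v, h.ssubset.subset hv⟩, hv⟩

theorem IsBond.exists_notMem (h : IsBond ℓ f S) : ∃ v : V(G), (v : α) ∉ S := by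
  obtain ⟨v, hv⟩ := h.compl.exists_mem
  exact ⟨v, hv.2⟩

theorem exists_enters_of_connected (hf : Connected (subgraphOf G ℓ f)) {u v : V(G)}
    (hu : (u : α) ∉ S) (hv : (v : α) ∈ S) :
    ∃ a : Arrow G, a.Enters S ∧ (ℓ a.edge : ℤ) ∣ grad f a := by
  by_contra! h
  refine absurd ((connected_subgraphOf_iff.1 hf).2 Sᶜ ⟨u, u.2, hu⟩ ?_ v.2) (by simpa using hv)
  intro a hd ha ha'
  exact h a ⟨ha, ha'⟩ hd

theorem IsBond.exists_enters (h : IsBond ℓ f S) :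
    ∃ a : Arrow G, a.Enters S ∧ (ℓ a.edge : ℤ) ∣ grad f a := by
  obtain ⟨v, hv⟩ := h.exists_mem
  obtain ⟨u, hu⟩ := h.exists_notMem
  exact exists_enters_of_connected h.connected hu hv

theorem IsBond.exists_eq_of_mem_levelFunctions (h : IsBond ℓ f S) {ψ : V(G) → ℝ}
    (hψ : ψ ∈ levelFunctions ℓ f (chi G S)) :
    ∃ c d : ℝ, ∀ v, ψ v = c + d * chi G S v := by
  obtain ⟨s, hs⟩ := h.exists_mem
  obtain ⟨t, ht⟩ := h.exists_notMem
  refine ⟨ψ t, ψ s - ψ t, fun v => ?_⟩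
  by_cases hv : (v : α) ∈ S
  · rw [chi_of_mem hv, eq_of_connected_induce_of_grad_eq_zero h.connected_induce
      (fun a hd h1 h2 => hψ a hd (grad_chi_eq_zero_iff.2 (by tauto))) hv hs]
    ring
  · rw [chi_of_notMem hv, eq_of_connected_induce_of_grad_eq_zero h.connected_induce_compl
      (fun a hd h1 h2 => hψ a hd (grad_chi_eq_zero_iff.2 (by have := h1.2; have := h2.2; tauto)))
      (v := v) (w := t) ⟨v.2, hv⟩ ⟨t.2, ht⟩]
    ring

theorem self_mem_levelFunctions (φ : V(G) → ℝ) : φ ∈ levelFunctions ℓ f φ := fun _ _ h => h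

theorem const_mem_levelFunctions (φ : V(G) → ℝ) (c : ℝ) :
    (fun _ => c) ∈ levelFunctions ℓ f φ := fun _ _ _ => sub_self c

theorem linearIndependent_one_pair {φ : V(G) → ℝ} {u v : V(G)} (h : φ u ≠ φ v) :
    LinearIndependent ℝ ![(fun _ => (1 : ℝ)), φ] := by
  rw [LinearIndependent.pair_iff]
  intro s t hst
  have hu := congrFun hst u
  have hv := congrFun hst v
  simp only [Pi.add_apply, Pi.smul_apply, smul_eq_mul, mul_one, Pi.zero_apply] at hu hv
  have : t * (φ u - φ v) = 0 := by linarith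
  have ht : t = 0 := (mul_eq_zero.1 this).resolve_right (sub_ne_zero.2 h)
  subst ht
  exact ⟨by linarith, rfl⟩

theorem finrank_span_one_pair {φ : V(G) → ℝ} {u v : V(G)} (h : φ u ≠ φ v) :
    Module.finrank ℝ (Submodule.span ℝ {(fun _ => (1 : ℝ)), φ}) = 2 := by
  have := finrank_span_eq_card (linearIndependent_one_pair h)
  rwa [Matrix.range_cons_cons_empty, Fintype.card_fin] at this

theorem span_one_pair_le (φ : V(G) → ℝ) :
    Submodule.span ℝ {(fun _ => (1 : ℝ)), φ} ≤ levelFunctions ℓ f φ := by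
  rw [Submodule.span_le]
  rintro ψ (rfl | rfl)
  · exact const_mem_levelFunctions _ _
  · exact self_mem_levelFunctions _

theorem IsBond.finrank_levelFunctions (h : IsBond ℓ f S) :
    Module.finrank ℝ (levelFunctions ℓ f (chi G S)) = 2 := by
  obtain ⟨s, hs⟩ := h.exists_mem
  obtain ⟨t, ht⟩ := h.exists_notMem
  rw [← finrank_span_one_pair (φ := chi G S) (u := s) (v := t)
    (by rw [chi_of_mem hs, chi_of_notMem ht]; exact one_ne_zero)]
  suffices levelFunctions ℓ f (chi G S) = Submodule.span ℝ {(fun _ => (1 : ℝ)), chi G S} by rw [this]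
  refine le_antisymm (fun ψ hψ => ?_) (span_one_pair_le _)
  obtain ⟨c, d, hcd⟩ := h.exists_eq_of_mem_levelFunctions hψ
  refine Submodule.mem_span_pair.2 ⟨c, d, funext fun v => ?_⟩
  simp [hcd]

theorem finrank_levelFunctions_of_const (hf : Connected (subgraphOf G ℓ f)) {φ : V(G) → ℝ}
    (h : ∀ v w, φ v = φ w) : Module.finrank ℝ (levelFunctions ℓ f φ) = 1 := by
  obtain ⟨v, hv⟩ := (connected_subgraphOf_iff.1 hf).1
  rw [← finrank_span_singleton (K := ℝ) (v := fun _ : V(G) => (1 : ℝ))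
    (fun h0 => one_ne_zero (congrFun h0 ⟨v, hv⟩))]
  suffices levelFunctions ℓ f φ = Submodule.span ℝ {fun _ : V(G) => (1 : ℝ)} by rw [this]
  refine le_antisymm (fun ψ hψ => ?_) ?_
  · refine Submodule.mem_span_singleton.2 ⟨ψ ⟨v, hv⟩, funext fun w => ?_⟩
    rw [eq_of_connected_of_grad_eq_zero hf (ψ := ψ)
      (fun a hd => hψ a hd (sub_eq_zero.2 (h _ _))) w ⟨v, hv⟩]
    simp
  · rw [Submodule.span_le]
    rintro ψ rfl
    exact const_mem_levelFunctions _ _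

section Finite

variable [Finite V(G)]

theorem const_of_finrank_levelFunctions {φ : V(G) → ℝ}
    (h : Module.finrank ℝ (levelFunctions ℓ f φ) = 1) (v w : V(G)) : φ v = φ w := by
  by_contra hne
  have := Submodule.finrank_mono (span_one_pair_le (ℓ := ℓ) (f := f) φ)
  rw [finrank_span_one_pair hne, h] at this
  omega

theorem exists_eq_of_finrank_levelFunctions {φ : V(G) → ℝ} {u v : V(G)} (hne : φ u ≠ φ v)
    (h : Module.finrank ℝ (levelFunctions ℓ f φ) = 2) {ψ : V(G) → ℝ}
    (hψ : ψ ∈ levelFunctions ℓ f φ) : ∃ c d : ℝ, ∀ v, ψ v = c + d * φ v := by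
  rw [← Submodule.eq_of_le_of_finrank_eq (span_one_pair_le φ)
    ((finrank_span_one_pair hne).trans h.symm)] at hψ
  obtain ⟨c, d, rfl⟩ := Submodule.mem_span_pair.1 hψ
  exact ⟨c, d, fun v => by simp⟩

/-- In dimension two the level functions are exactly the affine functions of φ. The indicator of the
maximum set S of φ is one of them, so φ takes two values. A proper non-empty part of either side
closed under the edges of G_f within that side would give a level function that is not affine in
χ_S. -/
theorem exists_isBond_of_finrank_levelFunctions (hf : Connected (subgraphOf G ℓ f))
    {φ : V(G) → ℝ} (h : Module.finrank ℝ (levelFunctions ℓ f φ) = 2) :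
    ∃ S, IsBond ℓ f S ∧ face ℓ f φ = face ℓ f (chi G S) := by
  obtain ⟨v₀, w₀, hne⟩ : ∃ v w, φ v ≠ φ w := by
    by_contra! hc
    rw [finrank_levelFunctions_of_const hf hc] at h
    omega
  have : Nonempty V(G) := ⟨v₀⟩
  obtain ⟨m, hm⟩ := Finite.exists_max φ
  let S : Set α := {x | ∃ hx : x ∈ V(G), φ ⟨x, hx⟩ = φ m}
  have hS : ∀ v : V(G), (v : α) ∈ S ↔ φ v = φ m := fun v =>
    ⟨fun ⟨_, h⟩ => h, fun h => ⟨v.2, h⟩⟩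
  obtain ⟨u, hu⟩ : ∃ u : V(G), (u : α) ∉ S := by
    by_contra! hc
    exact hne (((hS _).1 (hc v₀)).trans ((hS _).1 (hc w₀)).symm)
  have hmS : (m : α) ∈ S := (hS m).2 rfl
  have hum : φ u < φ m := lt_of_le_of_ne (hm u) fun h => hu ((hS u).2 h)
  have hlevel : ∀ a : Arrow G, grad φ a = 0 → ((a.tail : α) ∈ S ↔ (a.head : α) ∈ S) := by
    intro a ha
    rw [hS, hS, sub_eq_zero.1 ha]
  obtain ⟨c, d, hcd⟩ := exists_eq_of_finrank_levelFunctions hne h (ψ := chi G S)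
    fun a _ ha => grad_chi_eq_zero_iff.2 (hlevel a ha)
  have h1 := hcd m
  have h2 := hcd u
  rw [chi_of_mem hmS] at h1
  rw [chi_of_notMem hu] at h2
  have hd : 0 < d := by
    by_contra! hd
    nlinarith
  have hsub : S ⊂ V(G) := ⟨fun x hx => hx.1, fun h' => hu (h' u.2)⟩
  have hfun : ∀ T : Set α,
      (∀ a : Arrow G, (ℓ a.edge : ℤ) ∣ grad f a → ((a.tail : α) ∈ S ↔ (a.head : α) ∈ S) →
        (a.tail : α) ∈ T → (a.head : α) ∈ T) →
      ∃ c' d' : ℝ, ∀ v, chi G T v = c' + d' * chi G S v := by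
    intro T hT
    obtain ⟨c', d', h'⟩ := exists_eq_of_finrank_levelFunctions hne h (ψ := chi G T)
      (fun a hda ha => grad_chi_eq_zero_iff.2 ⟨hT a hda (hlevel a ha),
        hT a.rev (by rw [grad_rev, dvd_neg]; exact hda) (hlevel a ha).symm⟩)
    -- Eliminate φ = (χ_S - c) / d.
    refine ⟨c' - d' * c / d, d' / d, fun v => ?_⟩
    rw [h', hcd]
    field_simp
    ring
  refine ⟨S, ⟨hf, hsub, ?_, ?_⟩, face_congr fun a => ?_⟩
  · refine connected_induce_subgraphOf_iff.2 ⟨⟨m, hmS⟩, fun T ⟨v, hvS, hvT⟩ hT w hw => ?_⟩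
    obtain ⟨c', d', h'⟩ := hfun (T ∩ S) fun a hda haS ht =>
      ⟨hT a hda ht.2 (haS.1 ht.2) ht.1, haS.1 ht.2⟩
    have e1 := h' u
    have e2 := h' ⟨v, hvS.1⟩
    have e3 := h' ⟨w, hw.1⟩
    rw [chi_of_notMem hu, chi_of_notMem (fun h => hu h.2)] at e1
    rw [chi_of_mem (S := S) hvS, chi_of_mem (S := T ∩ S) ⟨hvT, hvS⟩] at e2
    rw [chi_of_mem (S := S) hw] at e3
    exact (chi_eq_one_iff.1 (e3.trans e2.symm)).1
  · refine connected_induce_subgraphOf_iff.2 ⟨⟨u, u.2, hu⟩, fun T ⟨v, hvS, hvT⟩ hT w hw => ?_⟩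
    obtain ⟨c', d', h'⟩ := hfun (T \ S) fun a hda haS ht =>
      ⟨hT a hda ⟨a.tail.2, ht.2⟩ ⟨a.head.2, fun h => ht.2 (haS.2 h)⟩ ht.1,
        fun h => ht.2 (haS.2 h)⟩
    have e1 := h' m
    have e2 := h' ⟨v, hvS.1⟩
    have e3 := h' ⟨w, hw.1⟩
    rw [chi_of_notMem (S := S) hvS.2, chi_of_mem (S := T \ S) ⟨hvT, hvS.2⟩] at e2
    rw [chi_of_notMem (S := S) hw.2] at e3
    exact (chi_eq_one_iff.1 (e3.trans e2.symm)).1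
  · have : grad (chi G S) a = d * grad φ a := by rw [grad, grad, hcd, hcd]; ring
    rw [this, mul_pos_iff_of_pos_left hd]

end Finite

section Pairing

variable [Fintype V(G)] [Fintype (Arrow G)] [G.Loopless]

theorem chi_mem_levelFunctions_of_face_subset (hℓ : ∀ e ∈ E(G), 0 < ℓ e) {φ ψ : V(G) → ℝ}
    (h : face ℓ f φ ⊆ face ℓ f ψ) : ψ ∈ levelFunctions ℓ f φ := by
  rw [mem_levelFunctions_iff_const hℓ]
  exact fun y hy z hz =>
    (mem_levelFunctions_iff_const hℓ).1 (self_mem_levelFunctions ψ) y (h hy) z (h hz)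

/-- Since χ_T is constant on the facet, it is affine in χ_S, so T is S or its complement. The
complement is excluded by an edge of G_f in the cut: its two bounds sum to 1, so they cannot both be
attained at a and ā. -/
theorem IsBond.mem_iff_of_face_subset (hℓ : ∀ e ∈ E(G), 0 < ℓ e) (hS : IsBond ℓ f S)
    {u v : V(G)} (hu : (u : α) ∉ T) (hv : (v : α) ∈ T)
    (h : face ℓ f (chi G S) ⊆ face ℓ f (chi G T)) (w : V(G)) : (w : α) ∈ T ↔ (w : α) ∈ S := by
  obtain ⟨c, d, hcd⟩ := hS.exists_eq_of_mem_levelFunctions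
    (chi_mem_levelFunctions_of_face_subset hℓ h)
  obtain ⟨a, haS, hda⟩ := hS.exists_enters
  have hp := facePoint_mem (f := f) hℓ (chi G S)
  have hpT := (dStar_mem_face_iff (fun a => (hp a).1) (chi G T)).1 (h ⟨_, hp, rfl⟩)
  have hsum := hi_add_hi_rev_of_dvd hda
  have hrev : ¬ a.rev.Enters T := by
    intro hr
    have h1 := ((mem_cubeFace_chi.1 hpT) a.rev).2 hr
    have h2 := ((mem_cubeFace_chi.1 hp) a).2 haS
    rw [C1.apply_rev] at h1
    linarith
  have hval : ∀ w, chi G T w = 0 ∨ chi G T w = 1 := by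
    intro w
    by_cases hw : (w : α) ∈ T
    · exact Or.inr (chi_of_mem hw)
    · exact Or.inl (chi_of_notMem hw)
  have ht := hcd a.tail
  have hh := hcd a.head
  rw [chi_of_notMem haS.1] at ht
  rw [chi_of_mem haS.2] at hh
  have hd0 : d ≠ 0 := by
    rintro rfl
    have e1 := hcd u
    have e2 := hcd v
    rw [chi_of_notMem hu] at e1
    rw [chi_of_mem hv] at e2
    linarith
  have htT : (a.tail : α) ∉ T := by
    intro htT
    rw [chi_of_mem htT] at ht
    by_cases hhT : (a.head : α) ∈ T
    · rw [chi_of_mem hhT] at hh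
      exact hd0 (by linarith)
    · exact hrev ⟨hhT, htT⟩
  have hhT : (a.head : α) ∈ T := by
    by_contra hhT
    rw [chi_of_notMem htT] at ht
    rw [chi_of_notMem hhT] at hh
    exact hd0 (by linarith)
  rw [chi_of_notMem htT] at ht
  rw [chi_of_mem hhT] at hh
  rw [← chi_eq_one_iff, ← chi_eq_one_iff, hcd w]
  have h1 : c = 0 := by linarith
  have h2 : d = 1 := by linarith
  rw [h1, h2, zero_add, one_mul]

/-! ### Cells of codimension zero and one -/

theorem mem_cellsOfCodim_zero_iff (hℓ : ∀ e ∈ E(G), 0 < ℓ e) {σ : Set (V(G) → ℝ)} [Nonempty V(G)] :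
    σ ∈ cellsOfCodim G ℓ 0 ↔ ∃ f, Connected (subgraphOf G ℓ f) ∧ σ = Vor G ℓ f := by
  rw [mem_cellsOfCodim_iff hℓ]
  constructor
  · rintro ⟨f, φ, hf, rfl, h⟩
    exact ⟨f, hf, face_eq_Vor hℓ (const_of_finrank_levelFunctions h)⟩
  · rintro ⟨f, hf, rfl⟩
    exact ⟨f, fun _ => 0, hf, (face_eq_Vor hℓ fun _ _ => rfl).symm,
      finrank_levelFunctions_of_const hf fun _ _ => rfl⟩

theorem mem_cellsOfCodim_one_iff (hℓ : ∀ e ∈ E(G), 0 < ℓ e) {σ : Set (V(G) → ℝ)} [Nonempty V(G)] :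
    σ ∈ cellsOfCodim G ℓ 1 ↔ ∃ f S, IsBond ℓ f S ∧ σ = face ℓ f (chi G S) := by
  rw [mem_cellsOfCodim_iff hℓ]
  constructor
  · rintro ⟨f, φ, hf, rfl, h⟩
    obtain ⟨S, hS, hφ⟩ := exists_isBond_of_finrank_levelFunctions hf h
    exact ⟨f, S, hS, hφ⟩
  · rintro ⟨f, S, hS, rfl⟩
    exact ⟨f, chi G S, hS.connected, rfl, hS.finrank_levelFunctions⟩

end Pairing

/-! ### Functions with the same gradient -/

theorem hi_congr (h : grad f = grad g) : hi ℓ f = hi ℓ g := by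
  funext a
  rw [hi, hi, delta_eq, delta_eq, h]

theorem face_eq_of_grad_eq (h : grad f = grad g) (φ : V(G) → ℝ) : face ℓ f φ = face ℓ g φ := by
  simp only [face, cubeFace, hi_congr h]

theorem Vor_eq_of_grad_eq (hℓ : ∀ e ∈ E(G), 0 < ℓ e) (h : grad f = grad g) :
    Vor G ℓ f = Vor G ℓ g := by
  rw [← face_eq_Vor hℓ (φ := fun _ => 0) fun _ _ => rfl, face_eq_of_grad_eq h,
    face_eq_Vor hℓ fun _ _ => rfl]

theorem dPoint_eq_of_grad_eq (h : grad f = grad g) : dPoint ℓ f = dPoint ℓ g := by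
  refine Subtype.ext (funext fun a => ?_)
  rw [dPoint_eq_hi, dPoint_eq_hi, hi_congr h]

theorem connected_congr_of_grad_eq (h : grad f = grad g) :
    Connected (subgraphOf G ℓ f) ↔ Connected (subgraphOf G ℓ g) := by
  rw [connected_subgraphOf_iff, connected_subgraphOf_iff, h]

/-- The integer 2𝔡_f(a) is even exactly on G_f, so G_f can be read off from 𝔡_f. There 𝔡_f(a) is
grad f(a) / ℓ, and connectedness spreads the equality to all edges. -/
theorem grad_eq_of_dPoint_eq (hℓ : ∀ e ∈ E(G), 0 < ℓ e) (hf : Connected (subgraphOf G ℓ f))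
    (h : dPoint ℓ f = dPoint ℓ g) : grad f = grad g := by
  have key : ∀ a : Arrow G, (ℓ a.edge : ℤ) ∣ grad f a → grad f a = grad g a := by
    intro a hd
    have h1 : ((delta ℓ f a : ℝ) - delta ℓ f a.rev) / 2 = (delta ℓ g a - delta ℓ g a.rev) / 2 :=
      congrFun (congrArg Subtype.val h) a
    have h2 : delta ℓ f a - delta ℓ f a.rev = delta ℓ g a - delta ℓ g a.rev := by
      have : (delta ℓ f a : ℝ) - delta ℓ f a.rev = delta ℓ g a - delta ℓ g a.rev := by linarith
      exact_mod_cast this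
    rw [delta_rev_of_dvd hd] at h2
    have hd' : (ℓ a.edge : ℤ) ∣ grad g a := by
      by_contra hn
      rw [delta_rev_of_not_dvd hℓ hn] at h2
      omega
    rw [delta_rev_of_dvd hd'] at h2
    rw [← Int.mul_ediv_cancel' hd, ← Int.mul_ediv_cancel' hd', ← delta_eq, ← delta_eq]
    congr 1
    omega
  funext a
  have := eq_of_connected_of_grad_eq_zero hf (ψ := g - f) (fun b hb => by
    have h1 := key b hb
    simp only [grad, Pi.sub_apply] at h1 ⊢
    omega) a.head a.tail
  simp only [grad, Pi.sub_apply] at this ⊢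
  omega

/-! ### Shifting a function on one side of a cut -/

theorem grad_shift_of_enters {a : Arrow G} (h : a.Enters S) (n : ℕ) :
    grad (shift f S n) a = grad f a + n := by
  simp only [grad, shift, Set.indicator_of_mem h.2, Set.indicator_of_notMem h.1, Pi.one_apply]
  ring

theorem grad_shift_of_iff {a : Arrow G} (h : (a.tail : α) ∈ S ↔ (a.head : α) ∈ S) (n : ℕ) :
    grad (shift f S n) a = grad f a := by
  by_cases h' : (a.head : α) ∈ S
  · simp [grad, shift, h, h']
  · simp [grad, shift, h, h']

theorem connected_induce_shift (h : IsBond ℓ f S) (n : ℕ) :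
    Connected ((subgraphOf G ℓ (shift f S n)).induce S) := by
  rw [connected_induce_subgraphOf_iff]
  refine ⟨(connected_induce_subgraphOf_iff.1 h.connected_induce).1, fun T hT hcl =>
    (connected_induce_subgraphOf_iff.1 h.connected_induce).2 T hT fun a hd h1 h2 =>
      hcl a ?_ h1 h2⟩
  rwa [grad_shift_of_iff (by tauto)]

theorem connected_induce_compl_shift (h : IsBond ℓ f S) (n : ℕ) :
    Connected ((subgraphOf G ℓ (shift f S n)).induce (V(G) \ S)) := by
  rw [connected_induce_subgraphOf_iff]
  refine ⟨(connected_induce_subgraphOf_iff.1 h.connected_induce_compl).1, fun T hT hcl =>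
    (connected_induce_subgraphOf_iff.1 h.connected_induce_compl).2 T hT fun a hd h1 h2 =>
      hcl a ?_ h1 h2⟩
  rwa [grad_shift_of_iff (iff_of_false h1.2 h2.2)]

/-- The shift leaves gradients inside both sides unchanged, so the sides stay connected and a single
cut edge joins them. -/
theorem connected_shift_iff (h : IsBond ℓ f S) (n : ℕ) :
    Connected (subgraphOf G ℓ (shift f S n)) ↔
      ∃ a : Arrow G, a.Enters S ∧ (ℓ a.edge : ℤ) ∣ grad f a + n := by
  constructor
  · intro hc
    obtain ⟨v, hv⟩ := h.exists_mem
    obtain ⟨u, hu⟩ := h.exists_notMem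
    obtain ⟨a, ha, hd⟩ := exists_enters_of_connected hc hu hv
    exact ⟨a, ha, by rwa [grad_shift_of_enters ha] at hd⟩
  · rintro ⟨a, ha, hd⟩
    rw [← grad_shift_of_enters ha] at hd
    refine connected_subgraphOf_iff.2 ⟨⟨_, a.head.2⟩, fun T ⟨v, hv, hvT⟩ hcl => ?_⟩
    have h1 := (connected_induce_subgraphOf_iff.1 (connected_induce_shift h n)).2 T
    have h2 := (connected_induce_subgraphOf_iff.1 (connected_induce_compl_shift h n)).2 T
    replace h1 := fun hne => h1 hne fun b hb _ _ => hcl b hb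
    replace h2 := fun hne => h2 hne fun b hb _ _ => hcl b hb
    have hd' : (ℓ a.rev.edge : ℤ) ∣ grad (shift f S n) a.rev := by
      rw [grad_rev, dvd_neg]; exact hd
    have both : S ⊆ T ∧ V(G) \ S ⊆ T := by
      by_cases hvS : v ∈ S
      · have hST := h1 ⟨v, hvS, hvT⟩
        exact ⟨hST, h2 ⟨a.tail, ⟨a.tail.2, ha.1⟩, hcl a.rev hd' (hST ha.2)⟩⟩
      · have hST := h2 ⟨v, ⟨hv, hvS⟩, hvT⟩
        exact ⟨h1 ⟨a.head, ha.2, hcl a hd (hST ⟨a.tail.2, ha.1⟩)⟩, hST⟩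
    intro w hw
    by_cases hwS : w ∈ S
    · exact both.1 hwS
    · exact both.2 ⟨hw, hwS⟩

theorem firstShift_spec (hℓ : ∀ e ∈ E(G), 0 < ℓ e) (h : IsBond ℓ f S) :
    0 < firstShift G ℓ f S ∧ Connected (subgraphOf G ℓ (shift f S (firstShift G ℓ f S))) := by
  obtain ⟨a, ha, hd⟩ := h.exists_enters
  -- The length of a cut edge of G_f is an admissible shift, so the infimum is not the default value
  -- 0.
  have hne : {n : ℕ | 0 < n ∧ Connected (subgraphOf G ℓ (shift f S n))}.Nonempty :=
    ⟨ℓ a.edge, hℓ _ a.edge_mem, (connected_shift_iff h _).2 ⟨a, ha, hd.add dvd_rfl⟩⟩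
  exact Nat.sInf_mem hne

theorem firstShift_le {n : ℕ} (hn : 0 < n) (h : Connected (subgraphOf G ℓ (shift f S n))) :
    firstShift G ℓ f S ≤ n := Nat.sInf_le ⟨hn, h⟩

/-- The first function `f + n χ_S` with `n > 0` whose subgraph is connected. -/
def nextFun (ℓ : β → ℕ) (f : V(G) → ℤ) (S : Set α) : V(G) → ℤ :=
  shift f S (firstShift G ℓ f S)

theorem IsBond.connected_nextFun (hℓ : ∀ e ∈ E(G), 0 < ℓ e) (h : IsBond ℓ f S) :
    Connected (subgraphOf G ℓ (nextFun ℓ f S)) := (firstShift_spec hℓ h).2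

theorem IsBond.nextFun (hℓ : ∀ e ∈ E(G), 0 < ℓ e) (h : IsBond ℓ f S) :
    IsBond ℓ (nextFun ℓ f S) (V(G) \ S) :=
  IsBond.compl ⟨h.connected_nextFun hℓ, h.ssubset, connected_induce_shift h _,
    connected_induce_compl_shift h _⟩

theorem IsBond.grad_lt_grad_nextFun (hℓ : ∀ e ∈ E(G), 0 < ℓ e) (h : IsBond ℓ f S) {a : Arrow G}
    (ha : a.Enters S) : grad f a < grad (MixedVoronoi.nextFun ℓ f S) a := by
  have := (firstShift_spec hℓ h).1
  rw [MixedVoronoi.nextFun, grad_shift_of_enters ha]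
  omega

theorem hi_nextFun_of_iff {a : Arrow G} (h : (a.tail : α) ∈ S ↔ (a.head : α) ∈ S) :
    hi ℓ (nextFun ℓ f S) a = hi ℓ f a := by
  rw [hi, hi, delta_eq, delta_eq, nextFun, grad_shift_of_iff h]

/-- The least shift moves grad f(a) strictly up, but not beyond the next multiple of ℓ: reaching
that multiple would already reconnect the graph. -/
theorem IsBond.hi_nextFun_rev (hℓ : ∀ e ∈ E(G), 0 < ℓ e) (h : IsBond ℓ f S) {a : Arrow G}
    (ha : a.Enters S) : hi ℓ (MixedVoronoi.nextFun ℓ f S) a.rev = -hi ℓ f a := by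
  have hm : (0 : ℤ) < ℓ a.edge := by exact_mod_cast hℓ _ a.edge_mem
  obtain ⟨hpos, -⟩ := firstShift_spec hℓ h
  suffices delta ℓ (MixedVoronoi.nextFun ℓ f S) a.rev = -delta ℓ f a - 1 by
    rw [hi, hi, this]; push_cast; ring
  rw [delta_eq, delta_eq, grad_rev, Arrow.rev_edge, MixedVoronoi.nextFun, grad_shift_of_enters ha]
  have h1 := Int.emod_add_mul_ediv (grad f a) (ℓ a.edge)
  have h2 := Int.emod_nonneg (grad f a) hm.ne'
  have h3 := Int.emod_lt_of_pos (grad f a) hm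
  have hle : (firstShift G ℓ f S : ℤ) ≤ ℓ a.edge - grad f a % ℓ a.edge := by
    have hm' : 0 < ((ℓ a.edge : ℤ) - grad f a % ℓ a.edge).toNat := by omega
    have := firstShift_le hm' ((connected_shift_iff h _).2 ⟨a, ha, ?_⟩)
    · omega
    · rw [Int.toNat_of_nonneg (by omega)]
      refine ⟨grad f a / ℓ a.edge + 1, ?_⟩
      linarith
  rw [Int.ediv_eq_iff_of_pos hm]
  constructor <;> nlinarith

theorem Arrow.cases_cut (S : Set α) (a : Arrow G) :
    ((a.tail : α) ∈ S ↔ (a.head : α) ∈ S) ∨ a.Enters S ∨ a.rev.Enters S := by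
  simp only [Arrow.Enters, Arrow.rev_tail, Arrow.rev_head]; tauto

/-- Already the two cube faces coincide, before applying `dStar`: across the cut the prescribed
values agree by `IsBond.hi_nextFun_rev`, and elsewhere the bounds are the same. -/
theorem IsBond.face_nextFun (hℓ : ∀ e ∈ E(G), 0 < ℓ e) (h : IsBond ℓ f S) :
    face ℓ (MixedVoronoi.nextFun ℓ f S) (chi G (V(G) \ S)) = face ℓ f (chi G S) := by
  refine congrArg (dStar '' ·) (Set.ext fun x => ?_)
  simp only [mem_cubeFace_chi, enters_sdiff_iff]
  constructor
  · intro hx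
    have key : ∀ a, a.Enters S → x.1 a = hi ℓ f a := by
      intro a ha
      have := (hx a.rev).2 ha
      rw [h.hi_nextFun_rev hℓ ha, C1.apply_rev] at this
      linarith
    refine fun a => ⟨?_, key a⟩
    rcases a.cases_cut S with ha | ha | ha
    · rw [← hi_nextFun_of_iff ha]; exact (hx a).1
    · exact (key a ha).le
    · have h1 := key _ ha
      have h2 := hi_add_hi_rev_nonneg (f := f) hℓ a
      rw [C1.apply_rev] at h1
      linarith
  · intro hx
    have key : ∀ a, a.rev.Enters S → x.1 a = hi ℓ (MixedVoronoi.nextFun ℓ f S) a := by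
      intro a ha
      have h1 := (hx a.rev).2 ha
      have h2 := h.hi_nextFun_rev hℓ ha
      rw [C1.apply_rev] at h1
      rw [Arrow.rev_rev] at h2
      linarith
    refine fun a => ⟨?_, key a⟩
    rcases a.cases_cut S with ha | ha | ha
    · rw [hi_nextFun_of_iff ha]; exact (hx a).1
    · have h1 := (hx a).1
      have h2 := hi_add_hi_rev_nonneg (f := MixedVoronoi.nextFun ℓ f S) hℓ a
      have h3 := h.hi_nextFun_rev hℓ ha
      linarith
    · exact (key a ha).le

/-! ### The points 𝔡_f and the pairs joining them -/

theorem eta_apply (a : Arrow G) : (eta G ℓ f S).1 a =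
    1 / 2 * E(subgraphOf G ℓ f).indicator (fun _ => grad (chi G S) a) a.edge +
      1 / 2 * E(subgraphOf G ℓ (nextFun ℓ f S)).indicator (fun _ => grad (chi G S) a) a.edge := rfl

theorem IsBond.dPoint_add_eta (hℓ : ∀ e ∈ E(G), 0 < ℓ e) (h : IsBond ℓ f S) :
    dPoint ℓ f + eta G ℓ f S = dPoint ℓ (MixedVoronoi.nextFun ℓ f S) := by
  have key : ∀ a : Arrow G, a.Enters S → (dPoint ℓ f + eta G ℓ f S).1 a =
      (dPoint ℓ (MixedVoronoi.nextFun ℓ f S)).1 a := by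
    intro a ha
    have hg : grad (chi G S) a = 1 := by rw [grad, chi_of_mem ha.2, chi_of_notMem ha.1, sub_zero]
    have hrev := h.hi_nextFun_rev hℓ ha
    change (dPoint ℓ f).1 a + (eta G ℓ f S).1 a = _
    rw [eta_apply, hg, dPoint_eq_hi, dPoint_eq_hi]
    -- This turns the claim into a linear identity in the four bounds of f and h at a and ā, which
    -- follows from `hrev`.
    have key : ∀ f : V(G) → ℤ, E(subgraphOf G ℓ f).indicator (fun _ => (1 : ℝ)) a.edge =
        hi ℓ f a + hi ℓ f a.rev := by
      intro f
      by_cases hd : (ℓ a.edge : ℤ) ∣ grad f a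
      · rw [Set.indicator_of_mem (mem_edgeSet_subgraphOf.2 hd), hi_add_hi_rev_of_dvd hd]
      · rw [Set.indicator_of_notMem (fun h => hd (mem_edgeSet_subgraphOf.1 h)),
          hi_add_hi_rev_of_not_dvd hℓ hd]
    rw [key, key]
    linarith
  refine Subtype.ext (funext fun a => ?_)
  rcases a.cases_cut S with ha | ha | ha
  · change (dPoint ℓ f).1 a + (eta G ℓ f S).1 a = _
    rw [eta_apply, grad_chi_eq_zero_iff.2 ha, dPoint_eq_hi, dPoint_eq_hi, hi_nextFun_of_iff ha,
      hi_nextFun_of_iff (a := a.rev) ha.symm]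
    simp
  · exact key a ha
  · have := key _ ha
    rw [C1.apply_rev, C1.apply_rev] at this
    exact neg_injective this

theorem mem_dEdges_iff (hℓ : ∀ e ∈ E(G), 0 < ℓ e) {e : Sym2 (C1 G)} : e ∈ dEdges G ℓ ↔
    ∃ f S, IsBond ℓ f S ∧ e = s(dPoint ℓ f, dPoint ℓ (nextFun ℓ f S)) := by
  constructor
  · rintro ⟨f, S, h1, h2, h3, h4, rfl⟩
    have h : IsBond ℓ f S := ⟨h1, h2, h3, h4⟩
    exact ⟨f, S, h, by rw [h.dPoint_add_eta hℓ]⟩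
  · rintro ⟨f, S, h, rfl⟩
    exact ⟨f, S, h.1, h.2, h.3, h.4, by rw [h.dPoint_add_eta hℓ]⟩

theorem mem_dVertices_of_mem_dEdges (hℓ : ∀ e ∈ E(G), 0 < ℓ e) {e : Sym2 (C1 G)}
    (he : e ∈ dEdges G ℓ) {x : C1 G} (hx : x ∈ e) : x ∈ dVertices G ℓ := by
  obtain ⟨f, S, hS, rfl⟩ := (mem_dEdges_iff hℓ).1 he
  rcases Sym2.mem_iff.1 hx with rfl | rfl
  · exact ⟨f, hS.connected, rfl⟩
  · exact ⟨_, hS.connected_nextFun hℓ, rfl⟩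

theorem not_isDiag_of_mem_dEdges (hℓ : ∀ e ∈ E(G), 0 < ℓ e) {e : Sym2 (C1 G)}
    (he : e ∈ dEdges G ℓ) : ¬ e.IsDiag := by
  obtain ⟨f, S, hS, rfl⟩ := (mem_dEdges_iff hℓ).1 he
  rw [Sym2.mk_isDiag_iff]
  intro h
  obtain ⟨a, ha, -⟩ := hS.exists_enters
  have := hS.grad_lt_grad_nextFun hℓ ha
  rw [grad_eq_of_dPoint_eq hℓ hS.connected h] at this
  exact lt_irrefl _ this

/-! ### The tiling property -/

/-- The two floors sum to at most (grad f(a) - grad g(a)) / ℓ < 0, hence by integrality to at most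
-1; the two halves restore 1. -/
theorem hi_add_hi_rev_le {a : Arrow G} (hℓ : ∀ e ∈ E(G), 0 < ℓ e) (h : grad f a < grad g a) :
    hi ℓ f a + hi ℓ g a.rev ≤ 0 := by
  have hm : (0 : ℤ) < ℓ a.edge := by exact_mod_cast hℓ _ a.edge_mem
  have h1 := Int.ediv_mul_le (grad f a) hm.ne'
  have h2 := Int.ediv_mul_le (-grad g a) hm.ne'
  have h3 : delta ℓ f a + delta ℓ g a.rev ≤ -1 := by
    rw [delta_eq, delta_eq, grad_rev, Arrow.rev_edge]
    by_contra! h4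
    nlinarith
  have h4 : (delta ℓ f a + delta ℓ g a.rev : ℝ) ≤ -1 := by exact_mod_cast h3
  rw [hi, hi]
  linarith

section Pairing

variable [Fintype V(G)] [Fintype (Arrow G)]

/-- For y in the cube of g, y(a) ≥ -hi_g(ā) ≥ hi_f(a) on arrows entering T. Hence χ_T is on all of
Vor(g) at least its maximum on Vor(f). -/
theorem Vor_inter_Vor_subset_face (hℓ : ∀ e ∈ E(G), 0 < ℓ e)
    (h : ∀ a : Arrow G, a.Enters T → grad f a < grad g a) :
    Vor G ℓ f ∩ Vor G ℓ g ⊆ face ℓ f (chi G T) := by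
  rintro _ ⟨⟨x, hx, rfl⟩, y, hy, hxy⟩
  rw [mem_cube_iff hℓ] at hx hy
  rw [dStar_mem_face_iff hx, ← dotProduct_dStar_eq_iff hx]
  refine (dotProduct_dStar_le hx _).antisymm ?_
  rw [← hxy, dotProduct_dStar_eq_sum_max]
  refine Finset.sum_le_sum fun a _ => ?_
  rcases le_or_gt (grad (chi G T) a) 0 with h0 | h0
  · rw [max_eq_right h0, zero_mul, zero_mul]
  · refine mul_le_mul_of_nonneg_left ?_ (le_max_right _ _)
    have h1 := hi_add_hi_rev_le hℓ (h a (grad_chi_pos_iff.1 h0))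
    have h2 := hy a.rev
    rw [C1.apply_rev] at h2
    linarith

theorem Vor_inter_Vor_subset_face_superlevel (hℓ : ∀ e ∈ E(G), 0 < ℓ e) (c : ℤ) :
    Vor G ℓ f ∩ Vor G ℓ g ⊆ face ℓ f (chi G (Subtype.val '' {v : V(G) | c ≤ g v - f v})) := by
  refine Vor_inter_Vor_subset_face hℓ fun a ha => ?_
  simp only [Arrow.Enters, Subtype.val_injective.mem_set_image, Set.mem_ofPred_eq] at ha
  simp only [grad]
  omega

variable [G.Loopless]

/-- All of Vor(f) lies in the face of each superlevel set of g - f. As G_f is connected, the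
indicator of such a set is constant, so g - f is constant. -/
theorem grad_eq_of_Vor_subset (hℓ : ∀ e ∈ E(G), 0 < ℓ e) (hf : Connected (subgraphOf G ℓ f))
    (h : Vor G ℓ f ⊆ Vor G ℓ g) : grad f = grad g := by
  have key : ∀ v w, g v - f v ≤ g w - f w := by
    intro v w
    have h1 := (Set.subset_inter subset_rfl h).trans
      (Vor_inter_Vor_subset_face_superlevel hℓ (g v - f v))
    rw [← face_eq_Vor hℓ (φ := fun _ => 0) fun _ _ => rfl] at h1
    have h2 := chi_mem_levelFunctions_of_face_subset hℓ h1
    have h3 := eq_of_connected_of_grad_eq_zero hf (fun a hd => h2 a hd (sub_self 0)) w v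
    rw [chi_of_mem (v := v) (Set.mem_image_of_mem _ (le_refl (g v - f v))), chi_eq_one_iff,
      Subtype.val_injective.mem_set_image] at h3
    exact h3
  funext a
  have h1 := key a.head a.tail
  have h2 := key a.tail a.head
  simp only [grad]
  omega

theorem IsBond.superlevel_iff (hℓ : ∀ e ∈ E(G), 0 < ℓ e) (hS : IsBond ℓ f S)
    (h : face ℓ f (chi G S) ⊆ Vor G ℓ g) {c : ℤ} {u v : V(G)} (hu : g u - f u < c)
    (hv : c ≤ g v - f v) (w : V(G)) : c ≤ g w - f w ↔ (w : α) ∈ S := by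
  have h1 := (Set.subset_inter (face_subset_Vor hℓ _) h).trans
    (Vor_inter_Vor_subset_face_superlevel hℓ c)
  rw [← hS.mem_iff_of_face_subset hℓ (u := u) (v := v) _ _ h1 w,
    Subtype.val_injective.mem_set_image]
  · rfl
  · rw [Subtype.val_injective.mem_set_image]
    exact not_le.2 hu
  · rw [Subtype.val_injective.mem_set_image]
    exact hv

theorem IsBond.grad_eq_or_of_face_subset (hℓ : ∀ e ∈ E(G), 0 < ℓ e) (hS : IsBond ℓ f S)
    (hg : Connected (subgraphOf G ℓ g)) (h : face ℓ f (chi G S) ⊆ Vor G ℓ g) :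
    grad g = grad f ∨ grad g = grad (MixedVoronoi.nextFun ℓ f S) := by
  by_cases hfg : ∀ v w, g v - f v ≤ g w - f w
  · left
    funext a
    have h1 := hfg a.head a.tail
    have h2 := hfg a.tail a.head
    simp only [grad]
    omega
  right
  push Not at hfg
  obtain ⟨y, x, hxy⟩ := hfg
  have hy := hS.superlevel_iff hℓ h hxy le_rfl
  have hyS := (hy y).1 le_rfl
  have hxS : (x : α) ∉ S := fun hx => absurd ((hy x).2 hx) (not_le.2 hxy)
  have hin : ∀ w : V(G), (w : α) ∈ S → g w - f w = g y - f y := by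
    intro w hw
    have h1 := (hy w).2 hw
    have h2 := (hS.superlevel_iff hℓ h (hxy.trans_le h1) le_rfl y).2 hyS
    omega
  have hout : ∀ w : V(G), (w : α) ∉ S → g w - f w = g x - f x := by
    intro w hw
    have h1 : g w - f w < g y - f y := not_le.1 fun h' => hw ((hy w).1 h')
    -- The threshold just above the value at w excludes w and, by integrality, still admits y; its
    -- superlevel set is S and misses x.
    have h2 := mt (hS.superlevel_iff hℓ h (lt_add_one (g w - f w)) h1 x).1 hxS
    have h3 := mt (hS.superlevel_iff hℓ h (lt_add_one (g x - f x)) hxy w).1 hw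
    omega
  obtain ⟨m, hm⟩ : ∃ m : ℕ, g y - f y = g x - f x + m :=
    ⟨(g y - f y - (g x - f x)).toNat, by omega⟩
  have hgrad : grad g = grad (shift f S m) := by
    have key : ∀ v, g v = shift f S m v + (g x - f x) := by
      intro v
      by_cases hv : (v : α) ∈ S
      · have := hin v hv
        simp only [shift, Set.indicator_of_mem hv, Pi.one_apply]
        omega
      · have := hout v hv
        simp only [shift, Set.indicator_of_notMem hv]
        omega
    funext a
    rw [grad, grad, key a.head, key a.tail, add_sub_add_right_eq_sub]
  have hn := firstShift_le (by omega) ((connected_congr_of_grad_eq hgrad).1 hg)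
  rcases hn.eq_or_lt with hn | hn
  · rw [hgrad, MixedVoronoi.nextFun, hn]
  exfalso
  -- Seen from h, the superlevel sets of g - h must be V - S; but with m > n, g - h is larger at y,
  -- which lies in S.
  have h' : face ℓ (MixedVoronoi.nextFun ℓ f S) (chi G (V(G) \ S)) ⊆ Vor G ℓ g := by
    rwa [hS.face_nextFun hℓ]
  have hnx : MixedVoronoi.nextFun ℓ f S x = f x := by
    simp [MixedVoronoi.nextFun, shift, hxS]
  have hny : MixedVoronoi.nextFun ℓ f S y = f y + firstShift G ℓ f S := by
    simp [MixedVoronoi.nextFun, shift, hyS]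
  have := ((hS.nextFun hℓ).superlevel_iff hℓ h' (u := x) (v := y)
    (c := g y - MixedVoronoi.nextFun ℓ f S y) (by omega) le_rfl y).1 le_rfl
  exact this.2 hyS

/-! ### Incidence of cells of codimension one -/

theorem IsBond.face_subset_Vor_iff (hℓ : ∀ e ∈ E(G), 0 < ℓ e) (hS : IsBond ℓ f S)
    (hg : Connected (subgraphOf G ℓ g)) : face ℓ f (chi G S) ⊆ Vor G ℓ g ↔
      dPoint ℓ g ∈ s(dPoint ℓ f, dPoint ℓ (MixedVoronoi.nextFun ℓ f S)) := by
  rw [Sym2.mem_iff]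
  constructor
  · intro h
    exact (hS.grad_eq_or_of_face_subset hℓ hg h).imp dPoint_eq_of_grad_eq dPoint_eq_of_grad_eq
  · rintro (h | h)
    · rw [Vor_eq_of_grad_eq hℓ (grad_eq_of_dPoint_eq hℓ hg h)]
      exact face_subset_Vor hℓ _
    · rw [Vor_eq_of_grad_eq hℓ (grad_eq_of_dPoint_eq hℓ hg h), ← hS.face_nextFun hℓ]
      exact face_subset_Vor hℓ _

/-- A facet contains the whole intersection of the two cells adjacent to it, so the pair of cells
determines it. -/
theorem IsBond.face_subset_of_eq (hℓ : ∀ e ∈ E(G), 0 < ℓ e) (hS : IsBond ℓ f S)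
    (hT : IsBond ℓ g T) (h : s(dPoint ℓ f, dPoint ℓ (MixedVoronoi.nextFun ℓ f S)) =
      s(dPoint ℓ g, dPoint ℓ (MixedVoronoi.nextFun ℓ g T))) :
    face ℓ g (chi G T) ⊆ face ℓ f (chi G S) := by
  refine (Set.subset_inter ?_ ?_).trans
    (Vor_inter_Vor_subset_face hℓ fun a ha => hS.grad_lt_grad_nextFun hℓ ha)
  · rw [hT.face_subset_Vor_iff hℓ hS.connected, ← h]
    exact Sym2.mem_mk_left _ _
  · rw [hT.face_subset_Vor_iff hℓ (hS.connected_nextFun hℓ), ← h]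
    exact Sym2.mem_mk_right _ _

theorem exists_cell_equiv [Nonempty V(G)] (hℓ : ∀ e ∈ E(G), 0 < ℓ e) :
    ∃ φ : dVertices G ℓ ≃ cellsOfCodim G ℓ 0, ∀ f (hf : Connected (subgraphOf G ℓ f)),
      (φ ⟨dPoint ℓ f, f, hf, rfl⟩ : Set (V(G) → ℝ)) = Vor G ℓ f := by
  choose F hF hFd using fun x : dVertices G ℓ => x.2
  let φ : dVertices G ℓ → cellsOfCodim G ℓ 0 := fun x =>
    ⟨Vor G ℓ (F x), (mem_cellsOfCodim_zero_iff hℓ).2 ⟨F x, hF x, rfl⟩⟩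
  have hφ : ∀ f (hf : Connected (subgraphOf G ℓ f)),
      (φ ⟨dPoint ℓ f, f, hf, rfl⟩ : Set (V(G) → ℝ)) = Vor G ℓ f := fun f hf =>
    Vor_eq_of_grad_eq hℓ (grad_eq_of_dPoint_eq hℓ (hF _) (hFd _))
  refine ⟨Equiv.ofBijective φ ⟨fun x y hxy => Subtype.ext ?_, ?_⟩, hφ⟩
  · rw [← hFd x, ← hFd y]
    exact dPoint_eq_of_grad_eq (grad_eq_of_Vor_subset hℓ (hF x) (congrArg Subtype.val hxy).le)
  · rintro ⟨σ, hσ⟩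
    obtain ⟨f, hf, rfl⟩ := (mem_cellsOfCodim_zero_iff hℓ).1 hσ
    exact ⟨⟨dPoint ℓ f, f, hf, rfl⟩, Subtype.ext (hφ f hf)⟩

theorem exists_facet_equiv [Nonempty V(G)] (hℓ : ∀ e ∈ E(G), 0 < ℓ e) :
    ∃ ψ : dEdges G ℓ ≃ cellsOfCodim G ℓ 1, ∀ (e : dEdges G ℓ) (f : V(G) → ℤ),
      Connected (subgraphOf G ℓ f) → ((ψ e).1 ⊆ Vor G ℓ f ↔ dPoint ℓ f ∈ e.1) := by
  choose F S hS heq using fun e : dEdges G ℓ => (mem_dEdges_iff hℓ).1 e.2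
  let ψ : dEdges G ℓ → cellsOfCodim G ℓ 1 := fun e =>
    ⟨face ℓ (F e) (chi G (S e)), (mem_cellsOfCodim_one_iff hℓ).2 ⟨F e, S e, hS e, rfl⟩⟩
  have hψ : ∀ (e : dEdges G ℓ) (f : V(G) → ℤ), Connected (subgraphOf G ℓ f) →
      ((ψ e).1 ⊆ Vor G ℓ f ↔ dPoint ℓ f ∈ e.1) := by
    intro e f hf
    rw [(hS e).face_subset_Vor_iff hℓ hf, ← heq]
  -- Injectivity: the endpoints of an edge are recovered as the points whose cells contain the
  -- facet.
  refine ⟨Equiv.ofBijective ψ ⟨fun e e' h => Subtype.ext (Sym2.ext fun x => ?_), ?_⟩, hψ⟩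
  · constructor
    · intro hx
      obtain ⟨f, hf, rfl⟩ := mem_dVertices_of_mem_dEdges hℓ e.2 hx
      rwa [← hψ e' f hf, ← h, hψ e f hf]
    · intro hx
      obtain ⟨f, hf, rfl⟩ := mem_dVertices_of_mem_dEdges hℓ e'.2 hx
      rwa [← hψ e f hf, h, hψ e' f hf]
  · rintro ⟨σ, hσ⟩
    obtain ⟨f, T, hT, rfl⟩ := (mem_cellsOfCodim_one_iff hℓ).1 hσ
    let e : dEdges G ℓ := ⟨_, (mem_dEdges_iff hℓ).2 ⟨f, T, hT, rfl⟩⟩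
    have he := heq e
    exact ⟨e, Subtype.ext ((hT.face_subset_of_eq hℓ (hS e) he).antisymm
      ((hS e).face_subset_of_eq hℓ hT he.symm))⟩

end Pairing

end MixedVoronoi

end

/-! ### The isomorphism, from the two bijections and incidence -/

theorem mainTheorem8 {α β : Type*} (G : Graph α β) [Finite G.vertexSet] [Finite G.edgeSet]
    [G.Loopless] (hG : MixedVoronoi.Connected G) (ℓ : β → ℕ) (hℓ : ∀ e ∈ G.edgeSet, 0 < ℓ e) :
    -- the pairs in `dEdges` are pairs of two distinct points of `dVertices`
    (∀ e ∈ MixedVoronoi.dEdges G ℓ, ¬ e.IsDiag ∧ ∀ x ∈ e, x ∈ MixedVoronoi.dVertices G ℓ) ∧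
    -- the two graphs are isomorphic
    ∃ φ : MixedVoronoi.dualOneSkeleton G ℓ ≃g MixedVoronoi.dGraph G ℓ,
      -- the polytope of `f` corresponds to the point of `f`
      (∀ (f : G.vertexSet → ℤ) (hf : MixedVoronoi.Connected (MixedVoronoi.subgraphOf G ℓ f)),
        (φ.symm ⟨MixedVoronoi.dPoint ℓ f, ⟨f, hf, rfl⟩⟩ : Set (G.vertexSet → ℝ)) =
          MixedVoronoi.Vor G ℓ f) ∧
      -- the edges of the dual (cells of codimension one) correspond to the pairs, with incidence
      ∃ ψ : MixedVoronoi.cellsOfCodim G ℓ 1 ≃ MixedVoronoi.dEdges G ℓ,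
        ∀ (P : MixedVoronoi.cellsOfCodim G ℓ 0) (σ : MixedVoronoi.cellsOfCodim G ℓ 1),
          σ.1 ⊆ P.1 ↔ (φ P : MixedVoronoi.C1 G) ∈ (ψ σ : Sym2 (MixedVoronoi.C1 G)) := by
  have : Finite (MixedVoronoi.Arrow G) := MixedVoronoi.Arrow.finite
  have : Nonempty G.vertexSet := hG.nonempty
  have := Fintype.ofFinite G.vertexSet
  have := Fintype.ofFinite (MixedVoronoi.Arrow G)
  refine ⟨fun e he => ⟨MixedVoronoi.not_isDiag_of_mem_dEdges hℓ he, fun x hx =>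
    MixedVoronoi.mem_dVertices_of_mem_dEdges hℓ he hx⟩, ?_⟩
  obtain ⟨φ, hφ⟩ := MixedVoronoi.exists_cell_equiv (G := G) hℓ
  obtain ⟨ψ, hψ⟩ := MixedVoronoi.exists_facet_equiv (G := G) hℓ
  have inc : ∀ (P : MixedVoronoi.cellsOfCodim G ℓ 0) (σ : MixedVoronoi.cellsOfCodim G ℓ 1),
      σ.1 ⊆ P.1 ↔ (φ.symm P : MixedVoronoi.C1 G) ∈ (ψ.symm σ : Sym2 (MixedVoronoi.C1 G)) := by
    intro P σ
    obtain ⟨⟨_, f, hf, rfl⟩, rfl⟩ := φ.surjective P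
    obtain ⟨e, rfl⟩ := ψ.surjective σ
    rw [hφ f hf, φ.symm_apply_apply, ψ.symm_apply_apply]
    exact hψ e f hf
  refine ⟨⟨φ.symm, ?_⟩, fun f hf => hφ f hf, ψ.symm, inc⟩
  intro P Q
  have hne : (φ.symm P : MixedVoronoi.C1 G) ≠ φ.symm Q ↔ P ≠ Q :=
    not_congr (Subtype.val_injective.eq_iff.trans φ.symm.injective.eq_iff)
  change s((φ.symm P : MixedVoronoi.C1 G), φ.symm Q) ∈ MixedVoronoi.dEdges G ℓ ∧
    (φ.symm P : MixedVoronoi.C1 G) ≠ φ.symm Q ↔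
      P ≠ Q ∧ ∃ σ ∈ MixedVoronoi.cellsOfCodim G ℓ 1, σ ⊆ P.1 ∧ σ ⊆ Q.1
  rw [hne, and_comm]
  refine and_congr_right fun hPQ => ?_
  constructor
  · intro h
    refine ⟨(ψ ⟨_, h⟩).1, (ψ ⟨_, h⟩).2, (inc P _).2 ?_, (inc Q _).2 ?_⟩
    · rw [ψ.symm_apply_apply]
      exact Sym2.mem_mk_left _ _
    · rw [ψ.symm_apply_apply]
      exact Sym2.mem_mk_right _ _
  · rintro ⟨σ, hσ, hP, hQ⟩
    -- An unordered pair containing two distinct points consists of exactly these points.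
    have h := (Sym2.mem_and_mem_iff (hne.2 hPQ)).1 ⟨(inc P ⟨σ, hσ⟩).1 hP, (inc Q ⟨σ, hσ⟩).1 hQ⟩
    rw [← h]
    exact (ψ.symm ⟨σ, hσ⟩).2
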